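/- **Theorem 4.6 (VE forecaster bound).** There is a universal constant $c>0$ such that the following holds. Let $\mathcal F$ be a nonempty class of measurable policies $f:\mathcal X\to\{0,1\}$ on a measurable space $\mathcal X$, of finite VC dimension $d$; let $n>d$, $\delta\in(0,1)$, and let $(x_1,\ell_1),\dots,(x_n,\ell_n)$ be i.i.d. draws from a probability distribution $D$ on $\mathcal X\times[0,1]^2$, where $\ell_t=(\ell_{0,t},\ell_{1,t})$ are the losses of the two arms. Write $\ell_D(f)=\mathbb E_{(x,\ell)\sim D}\,\ell_{f(x)}$. Let $$n'=\min\Bigl\{n,\ \Bigl\lceil\sqrt{n\bigl(2d\ln\tfrac{en}{d}+\ln\tfrac3\delta\bigr)}\Bigr\rceil\Bigr\}.$$ The forecaster VE chooses arms $I_1,\dots,I_n$, observing $x_t$ before choosing $I_t$ and only $\ell_{I_t,t}$ afterwards, as follows: (1) in rounds $1,\dots,n'$ it draws arms uniformly at random; (2) from $x_1,\dots,x_{n'}$ it builds, by some measurable rule, a finite $\mathcal F'\subseteq\mathcal F$ that contains for each $f\in\mathcal F$ exactly one $f'$ with $f'(x_t)=f(x_t)$ for all $t\le n'$; (3) in rounds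 $n'+1,\dots,n$ it plays Exp4.P with the $N=|\mathcal F'|$ policies of $\mathcal F'$ as experts, with $K=2$ arms, horizon $T=n-n'$ and confidence level $\delta/3$. Then, for every such rule in (2), with probability at least $1-\delta$ over the data and the internal randomization of VE, $$\sum_{t=1}^n \ell_{I_t,t}-n\inf_{f\in\mathcal F}\ell_D(f)\ \le\ c\,\sqrt{n\Bigl(d\ln\frac{en}{d}+\ln\frac3\delta\Bigr)},$$ where $d\ln\frac{en}{d}$ is read as $0$ if $d=0$. Here Exp4.P with $N$ experts, $K$ arms, horizon $T$ and confidence level $\delta'$ is the following forecaster. Put $p_{\min}=\min\{\tfrac1K,\sqrt{\ln N/(KT)}\}$ and $\beta=\sqrt{\ln(N/\delta')/(KT)}$, and start from $\widetilde Y_j=0$ for $j=1,\dots,N$. In each round it receives the advice $\xi^1,\dots,\xi^N$ (probability distributions over the arms; for a policy $f$ as expert, the point mass at $f(x_t)$), sets $q_j\propto\exp\bigl(\tfrac{p_{\min}}2\widetilde Y_j\bigr)$ and $p_i=(1-Kp_{\min})\sum_j q_j\xi^j_i+p_{\min}$, draws an arm $I$ from $p$, observes the gain $g_I=1-\ell_I$,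 and adds $\sum_i \xi^j_i\,\frac{g_I\mathbf 1_{I=i}+\beta}{p_i}$ to $\widetilde Y_j$ for each $j$. (If $N=1$, it simply follows the only expert.) -/

import Mathlib

open MeasureTheory ProbabilityTheory

noncomputable section

namespace ContextualBandit

/-! Stochastic contextual bandits with `K` arms. One data point is a pair `(x, ℓ)` of a context
and a vector of losses in `[0,1]^K`. -/

section Protocol

variable {X : Type*} [MeasurableSpace X] {K : ℕ}

/-- Statistical risk of the policy `f`, the expectation of `ℓ_{f(x)}` for `(x, ℓ) ∼ D`. -/
def risk (D : Measure (X × (Fin K → unitInterval))) (f : X → Fin K) : ℝ :=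
  ∫ z, (z.2 (f z.1) : ℝ) ∂D

/-- A randomized forecaster under bandit feedback. `prob t h x i` is the probability with which
arm `i` is drawn in a round that is preceded by `t` rounds and has context `x`; the history `h`
lists the context, the chosen arm and the loss of the chosen arm in each of those `t` rounds. -/
structure Forecaster (X : Type*) [MeasurableSpace X] (K : ℕ) where
  prob : (t : ℕ) → (Fin t → X × Fin K × unitInterval) → X → Fin K → ℝ
  prob_nonneg : ∀ t h x i, 0 ≤ prob t h x i
  sum_prob : ∀ t h x, ∑ i, prob t h x i = 1
  measurable_prob : ∀ t i, Measurable
    (fun p : (Fin t → X × Fin K × unitInterval) × X => prob t p.1 p.2 i)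

/-- What the forecaster has observed before round `t` (rounds are numbered from `0`), when the
data are `z` and the arms played are `a`. -/
def history {n : ℕ} (z : Fin n → X × (Fin K → unitInterval)) (a : Fin n → Fin K) (t : Fin n) :
    Fin t → X × Fin K × unitInterval :=
  fun s => ((z (Fin.castLE t.isLt.le s)).1, a (Fin.castLE t.isLt.le s),
    (z (Fin.castLE t.isLt.le s)).2 (a (Fin.castLE t.isLt.le s)))

/-- Probability, over the internal randomization only, of playing the arms `a` on the data `z`:
in each round the arm is drawn from the distribution prescribed by the forecaster. -/
def Forecaster.playProb (π : Forecaster X K) {n : ℕ} (z : Fin n → X × (Fin K → unitInterval))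
    (a : Fin n → Fin K) : ℝ :=
  ∏ t : Fin n, π.prob t (history z a t) (z t).1 (a t)

theorem Forecaster.playProb_nonneg (π : Forecaster X K) {n : ℕ}
    (z : Fin n → X × (Fin K → unitInterval)) (a : Fin n → Fin K) : 0 ≤ π.playProb z a :=
  Finset.prod_nonneg fun _ _ => π.prob_nonneg _ _ _ _

theorem Forecaster.sum_playProb (π : Forecaster X K) {n : ℕ}
    (z : Fin n → X × (Fin K → unitInterval)) : ∑ a, π.playProb z a = 1 := by
  induction n with
  | zero => simp [Forecaster.playProb]
  | succ n ih =>
    rw [← (Fin.snocEquiv (fun _ : Fin (n + 1) => Fin K)).sum_comp, Fintype.sum_prod_type,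
      Finset.sum_comm]
    rw [← ih (Fin.init z)]
    refine Finset.sum_congr rfl fun a _ => ?_
    have key : ∀ i : Fin K, π.playProb z (Fin.snocEquiv (fun _ : Fin (n + 1) => Fin K) (i, a))
        = π.playProb (Fin.init z) a *
          π.prob n (fun s => ((z s.castSucc).1, a s, (z s.castSucc).2 (a s)))
            (z (Fin.last n)).1 i := by
      intro i
      have hs : ∀ s : Fin n, (Fin.snoc a i : Fin (n + 1) → Fin K) s.castSucc = a s := fun s => by
        simp
      have hl : (Fin.snoc a i : Fin (n + 1) → Fin K) (Fin.last n) = i := by simp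
      change π.playProb z (Fin.snoc a i) = _
      unfold Forecaster.playProb
      rw [Fin.prod_univ_castSucc]
      congr 1
      · refine Finset.prod_congr rfl fun t _ => ?_
        rw [hs]
        have hh : history z (Fin.snoc a i) t.castSucc = history (Fin.init z) a t := by
          funext s
          have := hs (Fin.castLE t.isLt.le s)
          have e : Fin.castLE t.castSucc.isLt.le s = (Fin.castLE t.isLt.le s).castSucc := rfl
          simp only [history]
          rw [e, this]
          rfl
        rw [hh]
        rfl
      · rw [hl]
        have hh : history z (Fin.snoc a i) (Fin.last n)
            = fun s => ((z s.castSucc).1, a s, (z s.castSucc).2 (a s)) := by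
          funext s
          have e : Fin.castLE (Fin.last n).isLt.le s = Fin.castSucc (n := n) s := rfl
          simp only [history]
          rw [e, hs]
        rw [hh]
        rfl
    simp only [key]
    rw [← Finset.mul_sum, π.sum_prob, mul_one]

theorem Forecaster.measurable_playProb (π : Forecaster X K) {n : ℕ} (a : Fin n → Fin K) :
    Measurable fun z : Fin n → X × (Fin K → unitInterval) => π.playProb z a := by
  refine Finset.measurable_fun_prod _ fun t _ => ?_
  refine (π.measurable_prob t (a t)).comp
    (g := fun p : (Fin t → X × Fin K × unitInterval) × X => π.prob t p.1 p.2 (a t))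
    (f := fun z : Fin n → X × (Fin K → unitInterval) => (history z a t, (z t).1)) ?_
  unfold history
  fun_prop

/-- The law of the arms played in `n` rounds as a function of the data. -/
def Forecaster.playKernel (π : Forecaster X K) (n : ℕ) :
    Kernel (Fin n → X × (Fin K → unitInterval)) (Fin n → Fin K) where
  toFun z := ∑ a, ENNReal.ofReal (π.playProb z a) • Measure.dirac a
  measurable' := by
    refine Measure.measurable_of_measurable_coe _ fun s _ => ?_
    simp only [Measure.coe_finsetSum, Finset.sum_apply, Measure.smul_apply, smul_eq_mul]
    exact Finset.measurable_fun_sum _ fun a _ =>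
      (π.measurable_playProb a).ennreal_ofReal.mul_const _

instance (π : Forecaster X K) (n : ℕ) : IsMarkovKernel (π.playKernel n) where
  isProbabilityMeasure z := by
    constructor
    change (∑ a, ENNReal.ofReal (π.playProb z a) • Measure.dirac a : Measure _) Set.univ = 1
    simp only [Measure.coe_finsetSum, Finset.sum_apply, Measure.smul_apply, smul_eq_mul,
      measure_univ, mul_one]
    rw [← ENNReal.ofReal_sum_of_nonneg fun a _ => π.playProb_nonneg z a, π.sum_playProb,
      ENNReal.ofReal_one]

/-- The joint law of `n` i.i.d. data points drawn from `D` and of the arms that the forecaster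
plays on them. -/
def Forecaster.law (π : Forecaster X K) (D : Measure (X × (Fin K → unitInterval))) (n : ℕ) :
    Measure ((Fin n → X × (Fin K → unitInterval)) × (Fin n → Fin K)) :=
  (Measure.pi fun _ : Fin n => D) ⊗ₘ π.playKernel n

/-- Regret with respect to the class `F`, on the data `z` with the arms `a` played. -/
def regret (D : Measure (X × (Fin K → unitInterval))) (F : Set (X → Fin K)) {n : ℕ}
    (z : Fin n → X × (Fin K → unitInterval)) (a : Fin n → Fin K) : ℝ :=
  ∑ t, ((z t).2 (a t) : ℝ) - n * ⨅ f : F, risk D f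

end Protocol

section VCDimension

variable {X : Type*}

/-- `F` shatters the finite set `S`: every binary labelling of `S` is induced by a policy. -/
def Shatters (F : Set (X → Fin 2)) (S : Finset X) : Prop :=
  ∀ g : X → Fin 2, ∃ f ∈ F, ∀ x ∈ S, f x = g x

/-- The VC dimension of `F` is (finite and equal to) `d`. -/
def HasVCDim (F : Set (X → Fin 2)) (d : ℕ) : Prop :=
  IsGreatest {k : ℕ | ∃ S : Finset X, Shatters F S ∧ S.card = k} d

end VCDimension

section Exp4P

/-! The Exp4.P forecaster with `N` experts, `K` arms, horizon `T` and confidence level `δ`. The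
experts are `0, …, N - 1`; an advice vector `ξ` gives, for expert `j`, the distribution `ξ j` over
arms. Gains are one minus losses. -/

/-- The minimal probability `p_min` with which each arm is explored; it is capped at `1 / K`, so
that the mixture with the uniform distribution is always well-defined. -/
def exp4pMinProb (N K T : ℕ) : ℝ :=
  min (1 / K) √(Real.log N / (K * T))

/-- The bias of the gain estimates. -/
def exp4pBias (N K T : ℕ) (δ : ℝ) : ℝ :=
  √(Real.log (N / δ) / (K * T))

/-- Exponential weights over the experts, from their estimated cumulative gains `Y`, with learning
rate `p_min / 2`. -/
def exp4pExpertProb (N K T : ℕ) (Y : ℕ → ℝ) (j : ℕ) : ℝ :=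
  Real.exp (exp4pMinProb N K T / 2 * Y j) /
    ∑ k ∈ Finset.range N, Real.exp (exp4pMinProb N K T / 2 * Y k)

/-- The distribution over arms: the advice averaged over the experts, mixed with uniform
exploration. -/
def exp4pArmProb (N K T : ℕ) (Y : ℕ → ℝ) (ξ : ℕ → Fin K → ℝ) (i : Fin K) : ℝ :=
  (1 - K * exp4pMinProb N K T) * ∑ j ∈ Finset.range N, exp4pExpertProb N K T Y j * ξ j i
    + exp4pMinProb N K T

/-- Estimated cumulative gain of each expert after `t` rounds in which the advice, the drawn arm
and its observed gain are as listed. The estimated gain of arm `i` in a round where `I` was drawn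
from `p` and had gain `g` is `(g * 1_{I = i} + β) / p i`. (If `N = 1` then `p_min = 0` and this may
divide by zero, but then the only expert is followed whatever its estimated gain.) -/
def exp4pScore (N K T : ℕ) (δ : ℝ) :
    (t : ℕ) → (Fin t → (ℕ → Fin K → ℝ) × Fin K × ℝ) → ℕ → ℝ
  | 0, _ => fun _ => 0
  | t + 1, h => fun j =>
      exp4pScore N K T δ t (Fin.init h) j +
        ∑ i, (h (Fin.last t)).1 j i *
          (((if (h (Fin.last t)).2.1 = i then (h (Fin.last t)).2.2 else 0) + exp4pBias N K T δ) /
            exp4pArmProb N K T (exp4pScore N K T δ t (Fin.init h)) (h (Fin.last t)).1 i)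

theorem exp4pMinProb_nonneg (N K T : ℕ) : 0 ≤ exp4pMinProb N K T :=
  le_min (by positivity) (Real.sqrt_nonneg _)

theorem mul_exp4pMinProb_le_one (N K T : ℕ) : K * exp4pMinProb N K T ≤ 1 := by
  have h : (K : ℝ) * exp4pMinProb N K T ≤ K * (1 / K) :=
    mul_le_mul_of_nonneg_left (min_le_left _ _) (Nat.cast_nonneg K)
  refine h.trans ?_
  rw [mul_one_div]
  exact div_self_le_one _

theorem exp4pExpertProb_nonneg (N K T : ℕ) (Y : ℕ → ℝ) (j : ℕ) :
    0 ≤ exp4pExpertProb N K T Y j := by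
  unfold exp4pExpertProb
  positivity

theorem exp4pArmProb_nonneg (N K T : ℕ) (Y : ℕ → ℝ) (ξ : ℕ → Fin K → ℝ)
    (hξ : ∀ j i, 0 ≤ ξ j i) (i : Fin K) : 0 ≤ exp4pArmProb N K T Y ξ i :=
  add_nonneg (mul_nonneg (sub_nonneg.2 (mul_exp4pMinProb_le_one N K T))
    (Finset.sum_nonneg fun j _ => mul_nonneg (exp4pExpertProb_nonneg N K T Y j) (hξ j i)))
    (exp4pMinProb_nonneg N K T)

theorem sum_exp4pArmProb (N K T : ℕ) (hN : 0 < N) (Y : ℕ → ℝ) (ξ : ℕ → Fin K → ℝ)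
    (hξ : ∀ j, ∑ i, ξ j i = 1) : ∑ i, exp4pArmProb N K T Y ξ i = 1 := by
  have hq : ∑ j ∈ Finset.range N, exp4pExpertProb N K T Y j = 1 := by
    unfold exp4pExpertProb
    rw [← Finset.sum_div]
    exact div_self (Finset.sum_pos (fun _ _ => Real.exp_pos _)
      (Finset.nonempty_range_iff.2 hN.ne')).ne'
  unfold exp4pArmProb
  rw [Finset.sum_add_distrib, ← Finset.mul_sum, Finset.sum_comm]
  simp only [← Finset.mul_sum, hξ, mul_one, hq, Finset.sum_const, Finset.card_univ,
    Fintype.card_fin, nsmul_eq_mul]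
  ring

theorem measurable_exp4pArmProb {α : Type*} [MeasurableSpace α] (N K T : ℕ) {Y : α → ℕ → ℝ}
    {ξ : α → ℕ → Fin K → ℝ} (hY : Measurable Y) (hξ : Measurable ξ) (i : Fin K) :
    Measurable fun a => exp4pArmProb N K T (Y a) (ξ a) i := by
  unfold exp4pArmProb exp4pExpertProb
  fun_prop

theorem measurable_exp4pScore (N K T : ℕ) (δ : ℝ) (t : ℕ) :
    Measurable (exp4pScore N K T δ t) := by
  induction t with
  | zero => exact measurable_const
  | succ t ih =>
    have hprev : Measurable fun h : Fin (t + 1) → (ℕ → Fin K → ℝ) × Fin K × ℝ =>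
        exp4pScore N K T δ t (Fin.init h) := ih.comp (by unfold Fin.init; fun_prop)
    refine measurable_pi_lambda _ fun j => ?_
    refine (measurable_pi_iff.1 hprev j).add (Finset.measurable_fun_sum _ fun i _ => ?_)
    refine Measurable.mul (by fun_prop) (Measurable.div (Measurable.add_const ?_ _)
      (measurable_exp4pArmProb N K T hprev (by fun_prop) i))
    refine Measurable.ite ?_ (by fun_prop) measurable_const
    exact (measurableSet_singleton i).preimage
      (f := fun h : Fin (t + 1) → (ℕ → Fin K → ℝ) × Fin K × ℝ => (h (Fin.last t)).2.1)
      (by fun_prop)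

theorem measurable_exp4p_comp {α : Type*} [MeasurableSpace α] (K T : ℕ) (δ : ℝ) {t : ℕ}
    {N : α → ℕ} {h : α → Fin t → (ℕ → Fin K → ℝ) × Fin K × ℝ} {ξ : α → ℕ → Fin K → ℝ}
    (hN : Measurable N) (hh : Measurable h) (hξ : Measurable ξ) (i : Fin K) :
    Measurable fun a => exp4pArmProb (N a) K T (exp4pScore (N a) K T δ t (h a)) (ξ a) i := by
  have hfix : ∀ M : ℕ, Measurable fun a =>
      exp4pArmProb M K T (exp4pScore M K T δ t (h a)) (ξ a) i := by
    intro M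
    have hY : Measurable fun a => exp4pScore M K T δ t (h a) :=
      (measurable_exp4pScore M K T δ t).comp hh
    exact measurable_exp4pArmProb M K T hY hξ i
  generalize hg : (fun (M : ℕ) (a : α) =>
    exp4pArmProb M K T (exp4pScore M K T δ t (h a)) (ξ a) i) = g
  have hg' : ∀ M, Measurable (g M) := fun M => by rw [← hg]; exact hfix M
  have hall : Measurable fun q : ℕ × α => g q.1 q.2 := measurable_from_prod_countable_right hg'
  have heq : (fun a => exp4pArmProb (N a) K T (exp4pScore (N a) K T δ t (h a)) (ξ a) i)
      = fun a => g (N a) a := by rw [← hg]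
  rw [heq]
  exact hall.comp (hN.prodMk measurable_id)

end Exp4P

section VE

variable {X : Type*} [MeasurableSpace X]

/-- A measurable rule that builds, from the first `m` contexts `x`, a subclass `F'` of `F` that
contains, for each `f ∈ F`, exactly one policy agreeing with `f` on those contexts. The members of
`F'` are listed as `policy x 0, …, policy x (size x - 1)`. -/
structure RepresentativeRule (F : Set (X → Fin 2)) (m : ℕ) where
  size : (Fin m → X) → ℕ
  policy : (Fin m → X) → ℕ → X → Fin 2
  policy_mem : ∀ x, ∀ j < size x, policy x j ∈ F
  existsUnique : ∀ x, ∀ f ∈ F, ∃! j, j < size x ∧ ∀ t, f (x t) = policy x j (x t)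
  measurable_size : Measurable size
  measurable_policy : ∀ j, Measurable fun p : (Fin m → X) × X => policy p.1 j p.2

theorem RepresentativeRule.size_pos {F : Set (X → Fin 2)} {m : ℕ} (b : RepresentativeRule F m)
    (hF : F.Nonempty) (x : Fin m → X) : 0 < b.size x := by
  obtain ⟨f, hf⟩ := hF
  obtain ⟨j, hj, -⟩ := b.existsUnique x f hf
  exact (Nat.zero_le j).trans_lt hj.1

/-- The advice of the listed policies on the context `y`: a point mass at the chosen arm. -/
def RepresentativeRule.advice {F : Set (X → Fin 2)} {m : ℕ} (b : RepresentativeRule F m)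
    (x : Fin m → X) (y : X) (j : ℕ) (i : Fin 2) : ℝ :=
  if b.policy x j y = i then 1 else 0

/-- The arm distribution of the VE forecaster (`n` rounds, `m` of them exploratory, confidence
parameter `δ`): uniform in the first `m` rounds; afterwards that of Exp4.P, with horizon `n - m`
and confidence level `δ / 3`, run from round `m` on with the policies of `F'` as experts. -/
def veProb {F : Set (X → Fin 2)} {m : ℕ} (b : RepresentativeRule F m) (n : ℕ) (δ : ℝ)
    (t : ℕ) (h : Fin t → X × Fin 2 × unitInterval) (y : X) (i : Fin 2) : ℝ :=
  if ht : m ≤ t then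
    let x : Fin m → X := fun s => (h (Fin.castLE ht s)).1
    let past : Fin (t - m) → (ℕ → Fin 2 → ℝ) × Fin 2 × ℝ := fun s =>
      let o := h ⟨m + s, by omega⟩
      (b.advice x o.1, o.2.1, 1 - (o.2.2 : ℝ))
    exp4pArmProb (b.size x) 2 (n - m)
      (exp4pScore (b.size x) 2 (n - m) (δ / 3) (t - m) past) (b.advice x y) i
  else 1 / 2

theorem RepresentativeRule.measurable_advice {α : Type*} [MeasurableSpace α]
    {F : Set (X → Fin 2)} {m : ℕ} (b : RepresentativeRule F m) {x : α → Fin m → X} {y : α → X}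
    (hx : Measurable x) (hy : Measurable y) : Measurable fun a => b.advice (x a) (y a) := by
  refine measurable_pi_lambda _ fun j => measurable_pi_lambda _ fun i => ?_
  refine Measurable.ite ?_ measurable_const measurable_const
  exact (measurableSet_singleton i).preimage
    ((b.measurable_policy j).comp (hx.prodMk hy))

theorem measurable_veProb {F : Set (X → Fin 2)} {m : ℕ} (b : RepresentativeRule F m) (n : ℕ)
    (δ : ℝ) (t : ℕ) (i : Fin 2) : Measurable
      (fun p : (Fin t → X × Fin 2 × unitInterval) × X => veProb b n δ t p.1 p.2 i) := by
  unfold veProb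
  by_cases ht : m ≤ t
  · simp only [ht, dite_true]
    have hx : Measurable fun p : (Fin t → X × Fin 2 × unitInterval) × X =>
        (fun s : Fin m => (p.1 (Fin.castLE ht s)).1) := by fun_prop
    have hpast : Measurable fun p : (Fin t → X × Fin 2 × unitInterval) × X =>
        (fun s : Fin (t - m) =>
          ((b.advice (fun s : Fin m => (p.1 (Fin.castLE ht s)).1) (p.1 ⟨m + s, by omega⟩).1,
            (p.1 ⟨m + s, by omega⟩).2.1, 1 - ((p.1 ⟨m + s, by omega⟩).2.2 : ℝ)) :
              (ℕ → Fin 2 → ℝ) × Fin 2 × ℝ)) := by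
      refine measurable_pi_lambda _ fun s => ?_
      refine (b.measurable_advice hx (by fun_prop)).prodMk (Measurable.prodMk (by fun_prop) ?_)
      fun_prop
    exact measurable_exp4p_comp 2 (n - m) (δ / 3) (b.measurable_size.comp hx) hpast
      (b.measurable_advice hx measurable_snd) i
  · simp only [ht, dite_false]
    exact measurable_const

/-- The VE forecaster. -/
def ve {F : Set (X → Fin 2)} (hF : F.Nonempty) {m : ℕ} (b : RepresentativeRule F m) (n : ℕ)
    (δ : ℝ) : Forecaster X 2 where
  prob := veProb b n δ
  prob_nonneg t h x i := by
    unfold veProb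
    split_ifs
    · refine exp4pArmProb_nonneg _ _ _ _ _ (fun j i => ?_) _
      unfold RepresentativeRule.advice
      split_ifs <;> norm_num
    · norm_num
  sum_prob t h x := by
    by_cases ht : m ≤ t
    · simp only [veProb, ht, dite_true]
      exact sum_exp4pArmProb _ _ _ (b.size_pos hF _) _ _
        fun j => by simp [RepresentativeRule.advice]
    · simp [veProb, ht]
  measurable_prob := measurable_veProb b n δ

/-- The number of exploratory rounds, `√(n (2 d ln (e n / d) + ln (3 / δ)))` rounded up to an
integer and capped at `n`. For `d = 0` the term `2 d ln (e n / d)` is zero. -/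
def explorationRounds (n d : ℕ) (δ : ℝ) : ℕ :=
  min n ⌈√(n * (2 * d * Real.log (Real.exp 1 * n / d) + Real.log (3 / δ)))⌉₊

end VE

end ContextualBandit

end

open ContextualBandit

/-!
On fixed data the forecaster is a product of explicit arm distributions, so the internal
randomization is handled by finite sums; the data enter through the product measure only.

If `n ≤ 8 S`, where `S` is the square root in the claim, the bound is trivial, since the regret
never exceeds `n` (`regret_le`). Otherwise the number `m` of exploratory rounds lies between `S` and
`3 S`, which costs at most `3 S`, and at least half of the rounds are left for Exp4.P. Fix a policy
`f` whose risk is within `1 / n` of the infimum. Three events, each of probability at most `δ / 3`,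
have to be avoided.

* The representative of `f` disagrees with `f` in more than `S` rounds although it agrees with it in
  the first `m` (`measure_misrepresented_le`). The data are exchangeable, so it suffices to bound
  the fraction of bad permutations of each sample (`pi_measure_le_of_card_perm_le`). By the
  Sauer–Shelah lemma the class has at most `(e n / d) ^ d` traces on the sample
  (`log_card_traces_le`), and a random permutation hides a set of `S` disagreements from the first
  `m` rounds with probability at most `exp (- S m / n)` (`card_perm_forall_lt_notMem_le`). Only
  pairs with the fixed policy `f` are considered, which keeps the event measurable.
* The cumulative loss of `f` exceeds `n` times its risk by `S`; this is Hoeffding's inequality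
  (`pi_measureReal_sum_ge_le`).
* Exp4.P loses too much against the representative of `f` (`ve_exploit`). The exponential weights
  analysis (`exp4pScore_le`) bounds the estimated gain of each expert by the gain of the forecaster,
  up to a multiple of `∑ 1 / p_I`, where `p_I` is the probability of the drawn arm. Both the excess
  of the true over the estimated gain of an expert and that sum have tails controlled by
  exponential supermartingales (`sum_mul_exp_estimate_le_one`, `sum_mul_exp_inv_le_one` and
  `Forecaster.playKernel_real_sum_ge_le`). Bounding the second moments through `∑ 1 / p_I` avoids
  the usual assumption that the uniform expert is among the experts.

`regret_le_of_events` and `Forecaster.le_law_real` put these together.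
-/

namespace ContextualBandit

/-! ### Growth function of a class of finite VC dimension -/

open Classical in
/-- The traces of `F` on the points `x 0, …, x (n - 1)`: the sets of indices on which some policy
of `F` plays arm `1`. -/
noncomputable def traces {X : Type*} (F : Set (X → Fin 2)) {n : ℕ} (x : Fin n → X) :
    Finset (Finset (Fin n)) :=
  Finset.univ.filter fun S => ∃ f ∈ F, ∀ t, t ∈ S ↔ f (x t) = 1

theorem mem_traces {X : Type*} {F : Set (X → Fin 2)} {n : ℕ} {x : Fin n → X}
    {S : Finset (Fin n)} : S ∈ traces F x ↔ ∃ f ∈ F, ∀ t, t ∈ S ↔ f (x t) = 1 := by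
  simp [traces]

theorem fin_two_eq_of_iff {a b : Fin 2} (h : a = 1 ↔ b = 1) : a = b := by
  revert a b; decide

theorem vcDim_traces_le {X : Type*} {F : Set (X → Fin 2)} {d : ℕ} (hd : HasVCDim F d) {n : ℕ}
    (x : Fin n → X) : (traces F x).vcDim ≤ d := by
  classical
  refine Finset.sup_le fun S hS => ?_
  rw [Finset.mem_shatterer] at hS
  -- A shattered set of indices cannot contain two indices of the same point.
  have hinj : Set.InjOn x S := by
    intro s hs t ht hst
    by_contra hne
    obtain ⟨A, hA, hAS⟩ := hS (t := {s}) (by simpa using hs)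
    obtain ⟨f, -, hf⟩ := mem_traces.1 hA
    have h1 : s ∈ A := by
      have : s ∈ S ∩ A := by rw [hAS]; simp
      exact (Finset.mem_inter.1 this).2
    have h2 : t ∉ A := fun h => by
      have : t ∈ S ∩ A := Finset.mem_inter.2 ⟨ht, h⟩
      rw [hAS, Finset.mem_singleton] at this
      exact hne this.symm
    exact h2 ((hf t).2 (hst ▸ (hf s).1 h1))
  refine hd.2 ⟨S.image x, fun g => ?_, Finset.card_image_of_injOn hinj⟩
  obtain ⟨A, hA, hAS⟩ := hS (t := S.filter fun t => g (x t) = 1) (Finset.filter_subset _ _)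
  obtain ⟨f, hf, hfA⟩ := mem_traces.1 hA
  refine ⟨f, hf, fun y hy => ?_⟩
  obtain ⟨t, ht, rfl⟩ := Finset.mem_image.1 hy
  have : t ∈ S ∩ A ↔ t ∈ S.filter fun t => g (x t) = 1 := by rw [hAS]
  simp only [Finset.mem_inter, Finset.mem_filter, ht, true_and] at this
  exact fin_two_eq_of_iff ((hfA t).symm.trans this)

/-- The Sauer–Shelah lemma for the traces of a class of policies. -/
theorem card_traces_le {X : Type*} {F : Set (X → Fin 2)} {d : ℕ} (hd : HasVCDim F d) {n : ℕ}
    (x : Fin n → X) : (traces F x).card ≤ ∑ k ∈ Finset.range (d + 1), n.choose k := by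
  refine (Finset.card_le_card_shatterer _).trans (Finset.card_shatterer_le_sum_vcDim.trans ?_)
  rw [Fintype.card_fin]
  refine Finset.sum_le_sum_of_subset fun k hk => ?_
  simp only [Finset.mem_Iic, Finset.mem_range] at hk ⊢
  have := vcDim_traces_le hd x
  omega

/-- For `d = 0` both sides are `0`, the argument of the logarithm on the right being irrelevant. -/
theorem log_sum_choose_le {n d : ℕ} (h : d ≤ n) :
    Real.log (∑ k ∈ Finset.range (d + 1), n.choose k : ℕ) ≤ d * Real.log (Real.exp 1 * n / d) := by
  rcases Nat.eq_zero_or_pos d with rfl | hd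
  · simp
  have hd' : (0 : ℝ) < d := by exact_mod_cast hd
  have hn' : (0 : ℝ) < n := by exact_mod_cast hd.trans_le h
  have hle : (d : ℝ) / n ≤ 1 := (div_le_one hn').2 (by exact_mod_cast h)
  have hq : (0 : ℝ) < d / n := by positivity
  have hpos : (0 : ℝ) < (∑ k ∈ Finset.range (d + 1), n.choose k : ℕ) := by
    have : 0 < ∑ k ∈ Finset.range (d + 1), n.choose k :=
      Finset.sum_pos' (fun _ _ => Nat.zero_le _) ⟨0, by simp, by simp⟩
    exact_mod_cast this
  -- Weighting the `k`-th term by `(d / n) ^ k ≥ (d / n) ^ d` completes it to a binomial sum.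
  have key : (d / n : ℝ) ^ d * (∑ k ∈ Finset.range (d + 1), n.choose k : ℕ) ≤ Real.exp d := by
    calc (d / n : ℝ) ^ d * (∑ k ∈ Finset.range (d + 1), n.choose k : ℕ)
        = ∑ k ∈ Finset.range (d + 1), (d / n : ℝ) ^ d * n.choose k := by
          push_cast; rw [Finset.mul_sum]
      _ ≤ ∑ k ∈ Finset.range (d + 1), (d / n : ℝ) ^ k * n.choose k := by
          refine Finset.sum_le_sum fun k hk => ?_
          refine mul_le_mul_of_nonneg_right ?_ (Nat.cast_nonneg _)
          exact pow_le_pow_of_le_one hq.le hle (Nat.lt_succ_iff.1 (Finset.mem_range.1 hk))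
      _ ≤ ∑ k ∈ Finset.range (n + 1), (d / n : ℝ) ^ k * n.choose k := by
          refine Finset.sum_le_sum_of_subset_of_nonneg
            (Finset.range_subset_range.2 (by omega)) fun k _ _ => by positivity
      _ = (d / n + 1 : ℝ) ^ n := by rw [add_pow]; simp
      _ ≤ (Real.exp (d / n)) ^ n := by
          gcongr
          exact Real.add_one_le_exp _
      _ = Real.exp d := by
          rw [← Real.exp_nat_mul]
          congr 1
          field_simp
  have h2 := Real.log_le_log (by positivity) key
  rw [Real.log_mul (by positivity) hpos.ne', Real.log_pow, Real.log_exp,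
    Real.log_div hd'.ne' hn'.ne'] at h2
  rw [Real.log_div (by positivity) hd'.ne', Real.log_mul (by positivity) hn'.ne', Real.log_exp]
  linarith

theorem log_card_traces_le {X : Type*} {F : Set (X → Fin 2)} {d : ℕ} (hF : F.Nonempty)
    (hd : HasVCDim F d) {m n : ℕ} (hmn : m ≤ n) (hdn : d ≤ n) (x : Fin m → X) :
    Real.log (traces F x).card ≤ d * Real.log (Real.exp 1 * n / d) := by
  classical
  refine (Real.log_le_log ?_ ?_).trans (log_sum_choose_le hdn)
  · obtain ⟨f, hf⟩ := hF
    have : Finset.univ.filter (fun t => f (x t) = 1) ∈ traces F x :=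
      mem_traces.2 ⟨f, hf, by simp⟩
    exact_mod_cast Finset.card_pos.2 ⟨_, this⟩
  · exact_mod_cast (card_traces_le hd x).trans
      (Finset.sum_le_sum fun k _ => Nat.choose_le_choose k hmn)

/-! ### Random permutations -/

/-- Conditionally on `σ 0, …, σ (i - 1) ∈ T`, the remaining positions are exchangeable, so that
`σ i ∈ T` has conditional probability `(|T| - i) / (n - i)`. -/
theorem card_perm_step {n : ℕ} (T : Finset (Fin n)) {i : ℕ} (hi : i < n) :
    n * ((Finset.univ.filter fun σ : Equiv.Perm (Fin n) =>
        ∀ s : Fin n, (s : ℕ) < i + 1 → σ s ∈ T).card) ≤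
      T.card * (Finset.univ.filter fun σ : Equiv.Perm (Fin n) =>
        ∀ s : Fin n, (s : ℕ) < i → σ s ∈ T).card := by
  classical
  set E := Finset.univ.filter fun σ : Equiv.Perm (Fin n) => ∀ s : Fin n, (s : ℕ) < i → σ s ∈ T
    with hE
  set E' := Finset.univ.filter fun σ : Equiv.Perm (Fin n) =>
    ∀ s : Fin n, (s : ℕ) < i + 1 → σ s ∈ T with hE'
  have hswap : ∀ j : Fin n, E'.card ≤ (E.filter fun σ => σ j ∈ T).card := by
    intro j
    by_cases hj : (j : ℕ) < i
    · refine Finset.card_le_card fun σ hσ => ?_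
      simp only [hE, hE', Finset.mem_filter, Finset.mem_univ, true_and] at hσ ⊢
      exact ⟨fun s hs => hσ s (by omega), hσ j (by omega)⟩
    · refine Finset.card_le_card_of_injOn (fun σ => Equiv.swap ⟨i, hi⟩ j |>.trans σ) ?_ ?_
      · intro σ hσ
        simp only [hE, hE', Finset.coe_filter, Finset.mem_filter, Finset.mem_univ, true_and,
          Set.mem_ofPred_eq, Equiv.trans_apply] at hσ ⊢
        refine ⟨fun s hs => ?_, ?_⟩
        · rw [Equiv.swap_apply_of_ne_of_ne]
          · exact hσ s (by omega)
          · rintro rfl; simp at hs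
          · rintro rfl; exact hj hs
        · rw [Equiv.swap_apply_right]
          exact hσ _ (by simp)
      · intro σ _ τ _ h
        ext s
        have := congrArg (fun ρ : Equiv.Perm (Fin n) => ρ (Equiv.swap ⟨i, hi⟩ j s)) h
        simpa using congrArg Fin.val this
  calc n * E'.card = ∑ _j : Fin n, E'.card := by simp
    _ ≤ ∑ j : Fin n, (E.filter fun σ => σ j ∈ T).card := Finset.sum_le_sum fun j _ => hswap j
    _ = ∑ σ ∈ E, (Finset.univ.filter fun j => σ j ∈ T).card := by
        simp only [Finset.card_filter]
        rw [Finset.sum_comm]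
    _ = ∑ σ ∈ E, T.card := by
        refine Finset.sum_congr rfl fun σ _ => ?_
        refine Finset.card_bij (fun j _ => σ j) (by simp) (fun a _ b _ h => σ.injective h) ?_
        exact fun b hb => ⟨σ.symm b, by simpa using hb, by simp⟩
    _ = T.card * E.card := by rw [Finset.sum_const, smul_eq_mul, mul_comm]

theorem card_perm_forall_lt_mem_le {n : ℕ} (T : Finset (Fin n)) {m : ℕ} (hm : m ≤ n) :
    ((Finset.univ.filter fun σ : Equiv.Perm (Fin n) =>
        ∀ s : Fin n, (s : ℕ) < m → σ s ∈ T).card : ℝ) ≤ (T.card / n : ℝ) ^ m * n.factorial := by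
  induction m with
  | zero => simp [Fintype.card_perm]
  | succ i ih =>
    have hn : (0 : ℝ) < n := by exact_mod_cast (by omega : 0 < n)
    have h := card_perm_step T (show i < n by omega)
    have h' := (Nat.cast_le (α := ℝ)).2 h
    push_cast at h'
    have ih' := ih (by omega)
    rw [pow_succ]
    have h2 := mul_le_mul_of_nonneg_left ih' (Nat.cast_nonneg (α := ℝ) T.card)
    have h3 := h'.trans h2
    rw [← le_div_iff₀' hn] at h3
    refine h3.trans (le_of_eq ?_)
    ring

/-- Sampling without replacement misses a set of `k` among `n` indices in `m` draws with
probability at most `exp (- k m / n)`. -/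
theorem card_perm_forall_lt_notMem_le {n : ℕ} (S : Finset (Fin n)) {m : ℕ} (hm : m ≤ n) :
    ((Finset.univ.filter fun σ : Equiv.Perm (Fin n) =>
        ∀ s : Fin n, (s : ℕ) < m → σ s ∉ S).card : ℝ) ≤
      Real.exp (-(S.card * m / n)) * n.factorial := by
  classical
  have h := card_perm_forall_lt_mem_le Sᶜ hm
  simp only [Finset.mem_compl] at h
  refine h.trans (mul_le_mul_of_nonneg_right ?_ (Nat.cast_nonneg _))
  rcases Nat.eq_zero_or_pos n with rfl | hn
  · simp [show m = 0 by omega]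
  have hn' : (0 : ℝ) < n := by exact_mod_cast hn
  have hc : ((Sᶜ : Finset (Fin n)).card : ℝ) / n = 1 - S.card / n := by
    rw [Finset.card_compl, Fintype.card_fin, Nat.cast_sub (by simpa using S.card_le_univ)]
    field_simp
  calc (((Sᶜ : Finset (Fin n)).card : ℝ) / n) ^ m ≤ Real.exp (-(S.card / n)) ^ m := by
        refine pow_le_pow_left₀ (by positivity) ?_ m
        rw [hc]
        exact Real.one_sub_le_exp_neg _
    _ = Real.exp (-(S.card * m / n)) := by
        rw [← Real.exp_nat_mul]
        congr 1
        ring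

/-! ### Symmetrization and Hoeffding's inequality for i.i.d. data -/

/-- An event whose frequency among the permutations of each sample is at most `ε` has probability
at most `ε` under i.i.d. sampling. -/
theorem pi_measure_le_of_card_perm_le {Z : Type*} [MeasurableSpace Z] (D : Measure Z)
    [IsProbabilityMeasure D] {n : ℕ} {B : Set (Fin n → Z)} (hB : MeasurableSet B) {ε : ℝ}
    (h : ∀ (z : Fin n → Z) (P : Finset (Equiv.Perm (Fin n))),
      (∀ σ ∈ P, (fun t => z (σ t)) ∈ B) → (P.card : ℝ) ≤ ε * n.factorial) :
    (Measure.pi fun _ : Fin n => D) B ≤ ENNReal.ofReal ε := by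
  classical
  set μ : Measure (Fin n → Z) := Measure.pi fun _ : Fin n => D with hμ
  have hmp : ∀ σ : Equiv.Perm (Fin n), MeasurePreserving (fun z t => z (σ t)) μ μ := fun σ => by
    have := measurePreserving_arrowCongr' (α₁ := Fin n) (α₂ := Fin n) (fun _ => D) (fun _ => D)
      σ.symm (MeasurableEquiv.refl Z) (fun _ => MeasurePreserving.id D)
    exact this
  have hmeas : ∀ σ : Equiv.Perm (Fin n), MeasurableSet {z : Fin n → Z | (fun t => z (σ t)) ∈ B} :=
    fun σ => (hmp σ).measurable hB
  have hsum : (n.factorial : ENNReal) * μ B ≤ ENNReal.ofReal ε * n.factorial := by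
    calc (n.factorial : ENNReal) * μ B
        = ∑ σ : Equiv.Perm (Fin n), μ {z | (fun t => z (σ t)) ∈ B} := by
          have : ∀ σ : Equiv.Perm (Fin n), μ {z | (fun t => z (σ t)) ∈ B} = μ B := fun σ =>
            (hmp σ).measure_preimage hB.nullMeasurableSet
          simp [this, Fintype.card_perm]
      _ = ∫⁻ z, ∑ σ : Equiv.Perm (Fin n),
            Set.indicator {z : Fin n → Z | (fun t => z (σ t)) ∈ B} 1 z ∂μ := by
          rw [lintegral_finsetSum _ fun σ _ => measurable_one.indicator (hmeas σ)]
          exact Finset.sum_congr rfl fun σ _ => (lintegral_indicator_one (hmeas σ)).symm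
      _ ≤ ∫⁻ _, ENNReal.ofReal ε * n.factorial ∂μ := by
          refine lintegral_mono fun z => ?_
          have hz := h z (Finset.univ.filter fun σ => (fun t => z (σ t)) ∈ B) (by simp)
          have hε : 0 ≤ ε := by
            by_contra hneg
            have h1 : (0 : ℝ) < n.factorial := by exact_mod_cast n.factorial_pos
            have h2 := mul_neg_of_neg_of_pos (not_le.1 hneg) h1
            exact absurd ((Nat.cast_nonneg _).trans hz) (not_le.2 h2)
          have heq : ∑ σ : Equiv.Perm (Fin n),
              Set.indicator {z : Fin n → Z | (fun t => z (σ t)) ∈ B} (1 : (Fin n → Z) → ENNReal) z =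
              ((Finset.univ.filter fun σ : Equiv.Perm (Fin n) =>
                (fun t => z (σ t)) ∈ B).card : ENNReal) := by
            simp [Set.indicator_apply]
          refine heq.le.trans ?_
          calc _ = ENNReal.ofReal ((Finset.univ.filter fun σ : Equiv.Perm (Fin n) =>
                (fun t => z (σ t)) ∈ B).card : ℝ) := (ENNReal.ofReal_natCast _).symm
            _ ≤ ENNReal.ofReal (ε * n.factorial) := ENNReal.ofReal_le_ofReal hz
            _ = _ := by rw [ENNReal.ofReal_mul hε, ENNReal.ofReal_natCast]
      _ = ENNReal.ofReal ε * n.factorial := by simp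
  have h0 : (n.factorial : ENNReal) ≠ 0 := by exact_mod_cast n.factorial_ne_zero
  rw [mul_comm] at hsum
  exact (ENNReal.mul_le_mul_iff_left h0 (ENNReal.natCast_ne_top _)).1 hsum

/-- **Hoeffding's inequality** for `n` i.i.d. copies of a variable with values in `[0, 1]`. -/
theorem pi_measureReal_sum_ge_le {Z : Type*} [MeasurableSpace Z] (D : Measure Z)
    [IsProbabilityMeasure D] {g : Z → ℝ} (hg : Measurable g) (h01 : ∀ z, g z ∈ Set.Icc 0 1)
    {n : ℕ} (hn : 0 < n) {ε : ℝ} (hε : 0 ≤ ε) :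
    (Measure.pi fun _ : Fin n => D).real {z | n * ∫ y, g y ∂D + ε ≤ ∑ t, g (z t)} ≤
      Real.exp (-(2 * ε ^ 2 / n)) := by
  set μ : Measure (Fin n → Z) := Measure.pi fun _ : Fin n => D with hμ
  have hsub : HasSubgaussianMGF (fun y => g y - ∫ y, g y ∂D) ((‖(1 : ℝ) - 0‖₊ / 2) ^ 2) D :=
    hasSubgaussianMGF_of_mem_Icc hg.aemeasurable (.of_forall h01)
  have hind : iIndepFun (fun t (z : Fin n → Z) => g (z t) - ∫ y, g y ∂D) μ :=
    iIndepFun_pi (X := fun _ y => g y - ∫ y, g y ∂D) fun _ => (hg.sub_const _).aemeasurable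
  have hsub' : ∀ t ∈ (Finset.univ : Finset (Fin n)),
      HasSubgaussianMGF (fun z : Fin n → Z => g (z t) - ∫ y, g y ∂D)
        ((‖(1 : ℝ) - 0‖₊ / 2) ^ 2) μ := by
    intro t _
    have hmp := measurePreserving_eval (fun _ : Fin n => D) t
    exact HasSubgaussianMGF.of_map (Y := fun z : Fin n → Z => z t)
      (X := fun y => g y - ∫ y, g y ∂D) hmp.measurable.aemeasurable (by rw [hmp.map_eq]; exact hsub)
  have h := HasSubgaussianMGF.measure_sum_ge_le_of_iIndepFun hind hsub' hε
  have hset : {z : Fin n → Z | n * ∫ y, g y ∂D + ε ≤ ∑ t, g (z t)} =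
      {z | ε ≤ ∑ t, (g (z t) - ∫ y, g y ∂D)} := by
    ext z
    simp only [Set.mem_ofPred_eq, Finset.sum_sub_distrib, Finset.sum_const, Finset.card_univ,
      Fintype.card_fin, nsmul_eq_mul]
    constructor <;> intro h <;> linarith
  rw [hset]
  refine h.trans (Real.exp_le_exp.2 (le_of_eq ?_))
  have : (0 : ℝ) < n := by exact_mod_cast hn
  simp
  field_simp

/-! ### Exponential tail bounds for the arms played on fixed data -/

section Play

variable {X : Type*} {K : ℕ}

theorem history_snoc_castSucc {n : ℕ} (z : Fin (n + 1) → X × (Fin K → unitInterval))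
    (a : Fin n → Fin K) (i : Fin K) (t : Fin n) :
    history z (Fin.snoc a i) t.castSucc = history (Fin.init z) a t := by
  funext s
  have e : Fin.castLE t.castSucc.isLt.le s = (Fin.castLE t.isLt.le s).castSucc := rfl
  simp only [history]
  rw [e, Fin.snoc_castSucc]
  rfl

theorem history_snoc_last {n : ℕ} (z : Fin (n + 1) → X × (Fin K → unitInterval))
    (a : Fin n → Fin K) (i j : Fin K) :
    history z (Fin.snoc a i) (Fin.last n) = history z (Fin.snoc a j) (Fin.last n) := by
  funext s
  have e : Fin.castLE (Fin.last n).isLt.le s = Fin.castSucc (n := n) s := rfl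
  simp only [history]
  rw [e, Fin.snoc_castSucc, Fin.snoc_castSucc]

variable [MeasurableSpace X]

/-- A product of nonnegative factors with conditional expectations at most `1` has expectation at
most `1`. -/
theorem Forecaster.sum_playProb_mul_prod_le (π : Forecaster X K) {n : ℕ}
    (z : Fin n → X × (Fin K → unitInterval))
    (φ : (t : Fin n) → (Fin t → X × Fin K × unitInterval) → Fin K → ℝ)
    (hφ : ∀ t h i, 0 ≤ φ t h i)
    (hφ' : ∀ (t : Fin n) (a : Fin n → Fin K),
      ∑ i, π.prob t (history z a t) (z t).1 i * φ t (history z a t) i ≤ 1) :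
    ∑ a, π.playProb z a * ∏ t, φ t (history z a t) (a t) ≤ 1 := by
  simp only [Forecaster.playProb, ← Finset.prod_mul_distrib]
  induction n with
  | zero => simp
  | succ n ih =>
    rw [← (Fin.snocEquiv (fun _ : Fin (n + 1) => Fin K)).sum_comp, Fintype.sum_prod_type,
      Finset.sum_comm]
    refine le_trans (Finset.sum_le_sum fun a _ => ?_) (ih (Fin.init z) (fun t => φ t.castSucc)
      (fun t => hφ t.castSucc) fun t a => ?_)
    · change ∑ i, ∏ t : Fin (n + 1), (π.prob t (history z (Fin.snoc a i) t) (z t).1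
        ((Fin.snoc a i : Fin (n + 1) → Fin K) t) *
          φ t (history z (Fin.snoc a i) t) ((Fin.snoc a i : Fin (n + 1) → Fin K) t)) ≤ _
      simp only [Fin.prod_univ_castSucc, Fin.snoc_castSucc, Fin.snoc_last, history_snoc_castSucc]
      rw [← Finset.mul_sum]
      refine mul_le_of_le_one_right (Finset.prod_nonneg fun t _ =>
        mul_nonneg (π.prob_nonneg _ _ _ _) (hφ _ _ _)) ?_
      rcases isEmpty_or_nonempty (Fin K) with hK | ⟨⟨j⟩⟩
      · simp
      · refine le_trans (le_of_eq (Finset.sum_congr rfl fun i _ => ?_))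
          (hφ' (Fin.last n) (Fin.snoc a j))
        rw [history_snoc_last z a i j]
    · have := hφ' t.castSucc (Fin.snoc a (a t))
      rw [history_snoc_castSucc] at this
      exact this

open Classical in
theorem Forecaster.playKernel_real_apply (π : Forecaster X K) {n : ℕ}
    (z : Fin n → X × (Fin K → unitInterval)) (s : Set (Fin n → Fin K)) :
    (π.playKernel n z).real s = ∑ a, if a ∈ s then π.playProb z a else 0 := by
  have h : π.playKernel n z s =
      ENNReal.ofReal (∑ a, if a ∈ s then π.playProb z a else 0) := by
    change (∑ a, ENNReal.ofReal (π.playProb z a) • Measure.dirac a : Measure _) s = _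
    rw [ENNReal.ofReal_sum_of_nonneg fun a _ => by
      split_ifs
      · exact π.playProb_nonneg z a
      · exact le_rfl]
    simp only [Measure.coe_finsetSum, Finset.sum_apply, Measure.smul_apply, smul_eq_mul]
    refine Finset.sum_congr rfl fun a _ => ?_
    rw [Measure.dirac_apply' _ (Set.toFinite s).measurableSet]
    by_cases ha : a ∈ s <;> simp [ha]
  rw [measureReal_def, h, ENNReal.toReal_ofReal]
  refine Finset.sum_nonneg fun a _ => ?_
  split_ifs
  · exact π.playProb_nonneg z a
  · exact le_rfl

/-- The Chernoff bound for a sum of terms whose exponentials have conditional expectations at most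
`1` given the past. -/
theorem Forecaster.playKernel_real_sum_ge_le (π : Forecaster X K) {n : ℕ}
    (z : Fin n → X × (Fin K → unitInterval))
    (ψ : (t : Fin n) → (Fin t → X × Fin K × unitInterval) → Fin K → ℝ)
    (hψ : ∀ (t : Fin n) (a : Fin n → Fin K), ∑ i, π.prob t (history z a t) (z t).1 i *
      Real.exp (ψ t (history z a t) i) ≤ 1) (ε : ℝ) :
    (π.playKernel n z).real {a | ε ≤ ∑ t, ψ t (history z a t) (a t)} ≤ Real.exp (-ε) := by
  classical
  rw [π.playKernel_real_apply]
  have h := π.sum_playProb_mul_prod_le z (fun t h i => Real.exp (ψ t h i))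
    (fun _ _ _ => (Real.exp_pos _).le) hψ
  simp only [← Real.exp_sum] at h
  calc _ ≤ ∑ a, Real.exp (-ε) *
        (π.playProb z a * Real.exp (∑ t, ψ t (history z a t) (a t))) := by
        refine Finset.sum_le_sum fun a _ => ?_
        have h0 := π.playProb_nonneg z a
        split_ifs with ha
        · rw [mul_left_comm, ← Real.exp_add]
          refine le_mul_of_one_le_right h0 (Real.one_le_exp ?_)
          have : ε ≤ ∑ t, ψ t (history z a t) (a t) := ha
          linarith
        · positivity
    _ ≤ Real.exp (-ε) := by
        rw [← Finset.mul_sum]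
        exact mul_le_of_le_one_right (Real.exp_pos _).le h

/-- Arms of probability zero are almost surely never played. -/
theorem Forecaster.playKernel_real_exists_prob_eq_zero (π : Forecaster X K) {n : ℕ}
    (z : Fin n → X × (Fin K → unitInterval)) :
    (π.playKernel n z).real {a | ∃ t : Fin n, π.prob t (history z a t) (z t).1 (a t) = 0} = 0 := by
  classical
  rw [π.playKernel_real_apply]
  refine Finset.sum_eq_zero fun a _ => ?_
  split_ifs with ha
  · obtain ⟨t, ht⟩ := ha
    exact Finset.prod_eq_zero (Finset.mem_univ t) ht
  · rfl

end Play

/-! ### Exponential weights -/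

theorem exp_le_one_add_add_sq {x : ℝ} (hx : x ≤ 1) : Real.exp x ≤ 1 + x + x ^ 2 := by
  rcases le_total (-1) x with h | h
  · have := (abs_le.1 (Real.abs_exp_sub_one_sub_id_le (abs_le.2 ⟨h, hx⟩))).2
    linarith
  · have := Real.exp_le_one_iff.2 (h.trans (by norm_num : (-1 : ℝ) ≤ 0))
    nlinarith

/-- Second-order bound for the exponentially weighted average of `N` experts with gains `y s j`,
which may be arbitrarily negative, but not exceed `1 / η`. -/
theorem exp_weights_le {N : ℕ} {η : ℝ} {y : ℕ → ℕ → ℝ} {Y : ℕ → ℕ → ℝ}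
    {q : ℕ → ℕ → ℝ} (hY0 : ∀ j, Y 0 j = 0) (hY : ∀ t j, Y (t + 1) j = Y t j + y t j)
    (hq : ∀ t j, q t j = Real.exp (η * Y t j) / ∑ k ∈ Finset.range N, Real.exp (η * Y t k))
    {T : ℕ} (hy : ∀ t < T, ∀ j < N, η * y t j ≤ 1) {j : ℕ} (hj : j < N) :
    η * Y T j ≤ Real.log N + ∑ t ∈ Finset.range T,
      (η * ∑ k ∈ Finset.range N, q t k * y t k +
        η ^ 2 * ∑ k ∈ Finset.range N, q t k * y t k ^ 2) := by
  have hne : (Finset.range N).Nonempty := ⟨j, Finset.mem_range.2 hj⟩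
  set W : ℕ → ℝ := fun t => ∑ k ∈ Finset.range N, Real.exp (η * Y t k) with hW
  have hWpos : ∀ t, 0 < W t := fun t => Finset.sum_pos (fun _ _ => Real.exp_pos _) hne
  have hqsum : ∀ t, ∑ k ∈ Finset.range N, q t k = 1 := fun t => by
    simp only [hq]
    rw [← Finset.sum_div]
    exact div_self (hWpos t).ne'
  have hq0 : ∀ t k, 0 ≤ q t k := fun t k => by
    rw [hq]
    exact div_nonneg (Real.exp_pos _).le (hWpos t).le
  have hstep : ∀ t < T, Real.log (W (t + 1)) ≤ Real.log (W t) +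
      (η * ∑ k ∈ Finset.range N, q t k * y t k +
        η ^ 2 * ∑ k ∈ Finset.range N, q t k * y t k ^ 2) := by
    intro t ht
    have h1 : W (t + 1) = W t * ∑ k ∈ Finset.range N, q t k * Real.exp (η * y t k) := by
      rw [Finset.mul_sum]
      refine Finset.sum_congr rfl fun k _ => ?_
      have := (hWpos t).ne'
      rw [hq, hY, mul_add, Real.exp_add]
      change _ = W t * (Real.exp (η * Y t k) / W t * _)
      field_simp
    have h2 : ∑ k ∈ Finset.range N, q t k * Real.exp (η * y t k) ≤
        1 + (η * ∑ k ∈ Finset.range N, q t k * y t k +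
        η ^ 2 * ∑ k ∈ Finset.range N, q t k * y t k ^ 2) := by
      rw [← hqsum t, Finset.mul_sum, Finset.mul_sum, ← Finset.sum_add_distrib,
        ← Finset.sum_add_distrib]
      refine Finset.sum_le_sum fun k hk => ?_
      have := mul_le_mul_of_nonneg_left
        (exp_le_one_add_add_sq (hy t ht k (Finset.mem_range.1 hk))) (hq0 t k)
      refine this.trans (le_of_eq (by ring))
    have h3 : 0 < ∑ k ∈ Finset.range N, q t k * Real.exp (η * y t k) := by
      have := hWpos (t + 1)
      rw [h1] at this
      exact (mul_pos_iff_of_pos_left (hWpos t)).1 this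
    rw [h1, Real.log_mul (hWpos t).ne' h3.ne']
    gcongr
    have h4 := Real.log_le_sub_one_of_pos h3
    linarith
  have htot : ∀ t ≤ T, Real.log (W t) ≤ Real.log N + ∑ t ∈ Finset.range t,
      (η * ∑ k ∈ Finset.range N, q t k * y t k +
        η ^ 2 * ∑ k ∈ Finset.range N, q t k * y t k ^ 2) := by
    intro t ht
    induction t with
    | zero => simp [hW, hY0]
    | succ t ih =>
      rw [Finset.sum_range_succ]
      have h1 := ih (by omega)
      have h2 := hstep t (by omega)
      linarith
  refine le_trans ?_ (htot T le_rfl)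
  rw [← Real.log_exp (η * Y T j)]
  exact Real.log_le_log (Real.exp_pos _)
    (Finset.single_le_sum (f := fun k => Real.exp (η * Y T k))
      (fun _ _ => (Real.exp_pos _).le) (Finset.mem_range.2 hj))

/-! ### Estimated gains of Exp4.P -/

section Estimates

variable {K : ℕ}

/-- One round of Exp4.P: the first and second moments of the estimated gains under the weights `q`,
when the experts are mixed with uniform exploration at rate `p`. -/
theorem estimate_moments_le {N : ℕ} {q : ℕ → ℝ} (hq : ∀ j, 0 ≤ q j)
    {ξ : ℕ → Fin K → ℝ} (hξ : ∀ j i, 0 ≤ ξ j i)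
    (hξ1 : ∀ j, ∑ i, ξ j i = 1) {p β g : ℝ} (hp : 0 < p) (hKp : K * p ≤ 1 / 2) (hβ : 0 ≤ β)
    (hβ1 : β ≤ 1) (hg : 0 ≤ g) (hg1 : g ≤ 1) (I : Fin K) {P : Fin K → ℝ}
    (hP : ∀ i, P i = (1 - K * p) * ∑ j ∈ Finset.range N, q j * ξ j i + p) :
    p / 2 * ∑ j ∈ Finset.range N,
        q j * ∑ i, ξ j i * (((if I = i then g else 0) + β) / P i) +
      (p / 2) ^ 2 * ∑ j ∈ Finset.range N,
        q j * (∑ i, ξ j i * (((if I = i then g else 0) + β) / P i)) ^ 2 ≤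
      p / 2 * (g + 2 * (K * p) + 4 * (K * β) + 2 * (p / P I)) := by
  set v : Fin K → ℝ := fun i => ∑ j ∈ Finset.range N, q j * ξ j i with hv
  set G : Fin K → ℝ := fun i => ((if I = i then g else 0) + β) / P i with hG
  have hv0 : ∀ i, 0 ≤ v i := fun i => Finset.sum_nonneg fun j _ => mul_nonneg (hq j) (hξ j i)
  have hPp : ∀ i, p ≤ P i := fun i => by
    have := mul_nonneg (by linarith : (0 : ℝ) ≤ 1 - K * p) (hv0 i)
    rw [hP]; linarith
  have hP0 : ∀ i, 0 < P i := fun i => hp.trans_le (hPp i)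
  have hN0 : ∀ i, 0 ≤ (if I = i then g else 0) + β := fun i => by split_ifs <;> linarith
  have hG0 : ∀ i, 0 ≤ G i := fun i => div_nonneg (hN0 i) (hP0 i).le
  have hK0 : (0 : ℝ) ≤ K * p := by positivity
  have hvP : ∀ i, v i ≤ (1 + 2 * (K * p)) * P i := fun i => by
    have h1 : (1 - K * p) * v i ≤ P i := by rw [hP]; linarith
    have h2 : (1 + 2 * (K * p)) * ((1 - K * p) * v i) ≤ (1 + 2 * (K * p)) * P i :=
      mul_le_mul_of_nonneg_left h1 (by linarith)
    have h3 : 1 ≤ (1 + 2 * (K * p)) * (1 - K * p) := by nlinarith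
    have h4 := mul_le_mul_of_nonneg_right h3 (hv0 i)
    linarith
  have hPG : ∀ i, P i * G i = (if I = i then g else 0) + β := fun i =>
    mul_div_cancel₀ _ (hP0 i).ne'
  have hsumN : ∑ i, ((if I = i then g else 0) + β) = g + K * β := by
    simp [Finset.sum_add_distrib]
  have hfirst : ∑ j ∈ Finset.range N, q j * ∑ i, ξ j i * G i ≤
      g + 2 * (K * p) + 2 * (K * β) := by
    calc ∑ j ∈ Finset.range N, q j * ∑ i, ξ j i * G i = ∑ i, v i * G i := by
          simp only [hv, Finset.mul_sum, Finset.sum_mul]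
          rw [Finset.sum_comm]
          simp only [mul_assoc]
      _ ≤ ∑ i, (1 + 2 * (K * p)) * P i * G i :=
          Finset.sum_le_sum fun i _ => mul_le_mul_of_nonneg_right (hvP i) (hG0 i)
      _ = (1 + 2 * (K * p)) * (g + K * β) := by
          simp only [mul_assoc, hPG, ← Finset.mul_sum, hsumN]
      _ ≤ g + 2 * (K * p) + 2 * (K * β) := by
          have h1 : (0 : ℝ) ≤ K * β := by positivity
          nlinarith
  have hinv : ∀ i, 1 / P i ≤ 1 / p := fun i => one_div_le_one_div_of_le hp (hPp i)
  have hsumG : ∑ i, G i ≤ 1 / P I + K * β / p := by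
    have : ∀ i, G i = (if I = i then g / P i else 0) + β * (1 / P i) := fun i => by
      simp only [hG]
      split_ifs <;> ring
    simp only [this, Finset.sum_add_distrib]
    simp only [Finset.sum_ite_eq, Finset.mem_univ, if_true]
    refine add_le_add (div_le_div_of_nonneg_right hg1 (hP0 I).le) ?_
    calc ∑ i, β * (1 / P i) ≤ ∑ _i : Fin K, β * (1 / p) :=
          Finset.sum_le_sum fun i _ => mul_le_mul_of_nonneg_left (hinv i) hβ
      _ = K * β / p := by simp; ring
  have hsecond : ∑ j ∈ Finset.range N, q j * (∑ i, ξ j i * G i) ^ 2 ≤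
      4 * (1 / P I + K * β / p) := by
    calc ∑ j ∈ Finset.range N, q j * (∑ i, ξ j i * G i) ^ 2
        ≤ ∑ j ∈ Finset.range N, q j * ∑ i, ξ j i * G i ^ 2 := by
          refine Finset.sum_le_sum fun j _ => mul_le_mul_of_nonneg_left ?_ (hq j)
          have := (convexOn_pow 2).map_sum_le (t := Finset.univ) (w := ξ j) (p := G)
            (fun i _ => hξ j i) (hξ1 j) (fun i _ => hG0 i)
          simpa only [smul_eq_mul] using this
      _ = ∑ i, v i * G i ^ 2 := by
          simp only [hv, Finset.mul_sum, Finset.sum_mul]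
          rw [Finset.sum_comm]
          simp only [mul_assoc]
      _ ≤ ∑ i, 4 * G i := by
          refine Finset.sum_le_sum fun i _ => ?_
          have h1 : v i ≤ 2 * P i :=
            (hvP i).trans (mul_le_mul_of_nonneg_right (by linarith) (hP0 i).le)
          have h2 : P i * G i ≤ 2 := by
            rw [hPG]
            split_ifs <;> linarith
          calc v i * G i ^ 2 ≤ 2 * P i * G i ^ 2 :=
                mul_le_mul_of_nonneg_right h1 (sq_nonneg _)
            _ = 2 * (P i * G i) * G i := by ring
            _ ≤ 4 * G i := mul_le_mul_of_nonneg_right (by linarith) (hG0 i)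
      _ ≤ 4 * (1 / P I + K * β / p) := by
          rw [← Finset.mul_sum]
          exact mul_le_mul_of_nonneg_left hsumG (by norm_num)
  calc _ ≤ p / 2 * (g + 2 * (K * p) + 2 * (K * β)) +
        (p / 2) ^ 2 * (4 * (1 / P I + K * β / p)) :=
        add_le_add (mul_le_mul_of_nonneg_left hfirst (by positivity))
          (mul_le_mul_of_nonneg_left hsecond (by positivity))
    _ = _ := by
        have := hp.ne'
        have := (hP0 I).ne'
        field_simp
        ring

theorem exp4pArmProb_ge_minProb {N T : ℕ} (Y : ℕ → ℝ) {ξ : ℕ → Fin K → ℝ}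
    (hξ : ∀ j i, 0 ≤ ξ j i) (i : Fin K) : exp4pMinProb N K T ≤ exp4pArmProb N K T Y ξ i :=
  le_add_of_nonneg_left (mul_nonneg (sub_nonneg.2 (mul_exp4pMinProb_le_one N K T))
    (Finset.sum_nonneg fun j _ => mul_nonneg (exp4pExpertProb_nonneg N K T Y j) (hξ j i)))

/-- Upper bound for the estimated gain of every expert on the run of Exp4.P in which the advice,
the drawn arm and its gain in round `t` are given by `r t`. The sum of the inverse probabilities
of the drawn arms is all that remains of the second moments; it is controlled by
`sum_mul_exp_inv_le_one`. -/
theorem exp4pScore_le {N T : ℕ} {δ : ℝ} (r : ℕ → (ℕ → Fin K → ℝ) × Fin K × ℝ)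
    (hξ : ∀ t j i, 0 ≤ (r t).1 j i) (hξ1 : ∀ t j, ∑ i, (r t).1 j i = 1)
    (hg : ∀ t, (r t).2.2 ∈ Set.Icc (0 : ℝ) 1)
    (hp : 0 < exp4pMinProb N K T) (hKp : K * exp4pMinProb N K T ≤ 1 / 2)
    (hβ : exp4pBias N K T δ ≤ 1) {j : ℕ} (hj : j < N) :
    exp4pScore N K T δ T (fun s => r s) j ≤ 2 * Real.log N / exp4pMinProb N K T +
      ∑ t ∈ Finset.range T, ((r t).2.2 + 2 * (K * exp4pMinProb N K T) +
        4 * (K * exp4pBias N K T δ) + 2 * (exp4pMinProb N K T /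
          exp4pArmProb N K T (exp4pScore N K T δ t fun s => r s) (r t).1 (r t).2.1)) := by
  set p := exp4pMinProb N K T with hpdef
  set β := exp4pBias N K T δ with hβdef
  have hβ0 : 0 ≤ β := Real.sqrt_nonneg _
  set Y : ℕ → ℕ → ℝ := fun t => exp4pScore N K T δ t fun s => r s with hYdef
  set P : ℕ → Fin K → ℝ := fun t i => exp4pArmProb N K T (Y t) (r t).1 i with hPdef
  have hPp : ∀ t i, p ≤ P t i := fun t i => exp4pArmProb_ge_minProb (Y t) (hξ t) i
  have hy : ∀ t < T, ∀ j < N, p / 2 * ∑ i, (r t).1 j i *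
      (((if (r t).2.1 = i then (r t).2.2 else 0) + β) / P t i) ≤ 1 := by
    intro t _ j _
    have hle : ∀ i, ((if (r t).2.1 = i then (r t).2.2 else 0) + β) / P t i ≤ 2 / p := fun i => by
      have h1 := (hg t).1
      have h2 := (hg t).2
      refine div_le_div₀ (by norm_num) ?_ hp (hPp t i)
      split_ifs <;> linarith
    calc p / 2 * ∑ i, (r t).1 j i * (((if (r t).2.1 = i then (r t).2.2 else 0) + β) / P t i)
        ≤ p / 2 * ∑ i, (r t).1 j i * (2 / p) := by
          refine mul_le_mul_of_nonneg_left (Finset.sum_le_sum fun i _ => ?_) (by positivity)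
          exact mul_le_mul_of_nonneg_left (hle i) (hξ t j i)
      _ = 1 := by
          rw [← Finset.sum_mul, hξ1]
          field_simp
  have h := exp_weights_le (N := N) (η := p / 2) (Y := Y)
    (y := fun t j => ∑ i, (r t).1 j i *
      (((if (r t).2.1 = i then (r t).2.2 else 0) + β) / P t i))
    (q := fun t => exp4pExpertProb N K T (Y t)) (fun _ => rfl) (fun _ _ => rfl)
    (fun _ _ => rfl) hy hj
  have hsum := Finset.sum_le_sum fun t (_ : t ∈ Finset.range T) =>
    estimate_moments_le (N := N) (exp4pExpertProb_nonneg N K T (Y t)) (hξ t) (hξ1 t) hp hKp hβ0 hβ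
      (hg t).1 (hg t).2 (r t).2.1 (P := P t) (fun i => rfl)
  have h2 := h.trans (add_le_add_right hsum (Real.log N))
  rw [← Finset.mul_sum] at h2
  have h3 : Y T j ≤ (Real.log N + p / 2 * ∑ t ∈ Finset.range T, ((r t).2.2 + 2 * (K * p) +
      4 * (K * β) + 2 * (p / P t (r t).2.1))) / (p / 2) := by
    rw [le_div_iff₀ (by positivity)]
    linarith
  have h4 : ∀ S : ℝ, (Real.log N + p / 2 * S) / (p / 2) = 2 * Real.log N / p + S := fun S => by
    field_simp
  exact h3.trans (h4 _).le

/-- The estimated gain of arm `k` exceeds its true gain, in the sense of exponential moments. -/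
theorem sum_mul_exp_estimate_le_one {P : Fin K → ℝ} (hP : ∀ i, 0 < P i) (hP1 : ∑ i, P i = 1)
    {β g : ℝ} (hβ : 0 ≤ β) (hβ1 : β ≤ 1) (hg : 0 ≤ g) (hg1 : g ≤ 1) (k : Fin K) :
    ∑ i, P i * Real.exp (β * (g - ((if i = k then g else 0) + β) / P k)) ≤ 1 := by
  have hk := hP k
  have hle : ∀ i, Real.exp (β * (g - ((if i = k then g else 0) + β) / P k)) ≤
      (1 + β * (g - (if i = k then g else 0) / P k) +
        (β * (g - (if i = k then g else 0) / P k)) ^ 2) * Real.exp (-(β ^ 2 / P k)) := fun i => by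
    have e : β * (g - ((if i = k then g else 0) + β) / P k) =
        β * (g - (if i = k then g else 0) / P k) + -(β ^ 2 / P k) := by ring
    rw [e, Real.exp_add]
    refine mul_le_mul_of_nonneg_right (exp_le_one_add_add_sq ?_) (Real.exp_pos _).le
    have h0 : 0 ≤ (if i = k then g else 0) / P k := by split_ifs <;> positivity
    nlinarith
  have hmean : ∑ i, P i * (1 + β * (g - (if i = k then g else 0) / P k) +
        (β * (g - (if i = k then g else 0) / P k)) ^ 2) =
      1 + β ^ 2 * g ^ 2 * (1 / P k - 1) := by
    have e : ∀ i, P i * (1 + β * (g - (if i = k then g else 0) / P k) +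
        (β * (g - (if i = k then g else 0) / P k)) ^ 2) =
        P i * (1 + β * g + β ^ 2 * g ^ 2) +
          if i = k then (- β * g - 2 * β ^ 2 * g ^ 2 + β ^ 2 * g ^ 2 / P k) else 0 := fun i => by
      split_ifs with h
      · subst h
        field_simp
        ring
      · ring
    simp only [e, Finset.sum_add_distrib, ← Finset.sum_mul, hP1]
    simp
    ring
  calc ∑ i, P i * Real.exp (β * (g - ((if i = k then g else 0) + β) / P k))
      ≤ ∑ i, P i * ((1 + β * (g - (if i = k then g else 0) / P k) +
        (β * (g - (if i = k then g else 0) / P k)) ^ 2) * Real.exp (-(β ^ 2 / P k))) :=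
        Finset.sum_le_sum fun i _ => mul_le_mul_of_nonneg_left (hle i) (hP i).le
    _ = (1 + β ^ 2 * g ^ 2 * (1 / P k - 1)) * Real.exp (-(β ^ 2 / P k)) := by
        simp only [← mul_assoc, ← Finset.sum_mul, hmean]
    _ ≤ Real.exp (β ^ 2 / P k) * Real.exp (-(β ^ 2 / P k)) := by
        refine mul_le_mul_of_nonneg_right ?_ (Real.exp_pos _).le
        refine le_trans ?_ (Real.add_one_le_exp _)
        have h1 : g ^ 2 ≤ 1 := pow_le_one₀ hg hg1
        have h2 : β ^ 2 * g ^ 2 ≤ β ^ 2 := mul_le_of_le_one_right (sq_nonneg _) h1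
        have h3 : β ^ 2 * g ^ 2 * (1 / P k) ≤ β ^ 2 * (1 / P k) :=
          mul_le_mul_of_nonneg_right h2 (by positivity)
        have h4 : 0 ≤ β ^ 2 * g ^ 2 := by positivity
        have h5 : β ^ 2 / P k = β ^ 2 * (1 / P k) := by ring
        rw [h5]
        linarith
    _ = 1 := by rw [← Real.exp_add, add_neg_cancel, Real.exp_zero]

/-- The inverse probability of the drawn arm has mean `K`; the exponential moment of its multiple
by the exploration rate `p` is accordingly small. -/
theorem sum_mul_exp_inv_le_one {P : Fin K → ℝ} {p : ℝ} (hp : 0 < p) (hP : ∀ i, p ≤ P i)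
    (hP1 : ∑ i, P i = 1) : ∑ i, P i * Real.exp (p / P i - 2 * (K * p)) ≤ 1 := by
  have hle : ∀ i, P i * Real.exp (p / P i - 2 * (K * p)) ≤
      (P i + 2 * p) * Real.exp (-(2 * (K * p))) := fun i => by
    have hi : 0 < P i := hp.trans_le (hP i)
    have h1 : p / P i ≤ 1 := (div_le_one hi).2 (hP i)
    have h0 : 0 ≤ p / P i := by positivity
    rw [sub_eq_add_neg, Real.exp_add, ← mul_assoc]
    refine mul_le_mul_of_nonneg_right ?_ (Real.exp_pos _).le
    have h2 : Real.exp (p / P i) ≤ 1 + 2 * (p / P i) := by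
      have := exp_le_one_add_add_sq h1
      nlinarith
    calc P i * Real.exp (p / P i) ≤ P i * (1 + 2 * (p / P i)) :=
          mul_le_mul_of_nonneg_left h2 hi.le
      _ = P i + 2 * p := by field_simp
  calc _ ≤ ∑ i, (P i + 2 * p) * Real.exp (-(2 * (K * p))) := Finset.sum_le_sum fun i _ => hle i
    _ = (2 * (K * p) + 1) * Real.exp (-(2 * (K * p))) := by
        rw [← Finset.sum_mul, Finset.sum_add_distrib, hP1]
        simp
        ring
    _ ≤ Real.exp (2 * (K * p)) * Real.exp (-(2 * (K * p))) :=
        mul_le_mul_of_nonneg_right (Real.add_one_le_exp _) (Real.exp_pos _).le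
    _ = 1 := by rw [← Real.exp_add, add_neg_cancel, Real.exp_zero]

end Estimates

/-! ### The exploitation rounds of VE -/

section Exploitation

variable {X : Type*} [MeasurableSpace X] {F : Set (X → Fin 2)} {m n : ℕ}

/-- The rounds `m, …, n - 1`. -/
def roundsFrom (m n : ℕ) : Finset (Fin n) := Finset.univ.filter fun t => m ≤ (t : ℕ)

theorem mem_roundsFrom {t : Fin n} : t ∈ roundsFrom m n ↔ m ≤ (t : ℕ) := by simp [roundsFrom]

theorem sum_range_sub_eq_sum_roundsFrom (U : ℕ → ℝ) :
    ∑ s ∈ Finset.range (n - m), U s = ∑ t ∈ roundsFrom m n, U (t - m) := by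
  symm
  refine Finset.sum_bij (fun t _ => (t : ℕ) - m) (fun t ht => ?_) (fun t ht u hu h => ?_)
    (fun s hs => ?_) fun _ _ => rfl
  · have := mem_roundsFrom.1 ht
    have := t.isLt
    simp only [Finset.mem_range]
    omega
  · have := mem_roundsFrom.1 ht
    have := mem_roundsFrom.1 hu
    ext
    omega
  · have := Finset.mem_range.1 hs
    exact ⟨⟨m + s, by omega⟩, mem_roundsFrom.2 (by simp), by simp⟩

theorem card_roundsFrom (h : m ≤ n) : ((roundsFrom m n).card : ℝ) = n - m := by
  have := sum_range_sub_eq_sum_roundsFrom (m := m) (n := n) fun _ => (1 : ℝ)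
  simp only [Finset.sum_const, Finset.card_range, nsmul_eq_mul, mul_one] at this
  rw [← this, Nat.cast_sub h]

/-- The first `m` contexts of the data `z`. -/
def firstContexts (hm : m ≤ n) (z : Fin n → X × (Fin 2 → unitInterval)) : Fin m → X :=
  fun s => (z (Fin.castLE hm s)).1

/-- What Exp4.P sees in its round `s`, that is, in round `m + s` of VE, on the data `z` when the
arms `a` are played. The value beyond the horizon is an arbitrary valid record. -/
def exploitRecord (b : RepresentativeRule F m) (hm : m ≤ n)
    (z : Fin n → X × (Fin 2 → unitInterval)) (a : Fin n → Fin 2) (s : ℕ) :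
    (ℕ → Fin 2 → ℝ) × Fin 2 × ℝ :=
  if h : m + s < n then
    (b.advice (firstContexts hm z) (z ⟨m + s, h⟩).1, a ⟨m + s, h⟩,
      1 - ((z ⟨m + s, h⟩).2 (a ⟨m + s, h⟩) : ℝ))
  else (fun _ i => if 0 = i then 1 else 0, 0, 0)

theorem exploitRecord_sub (b : RepresentativeRule F m) (hm : m ≤ n)
    (z : Fin n → X × (Fin 2 → unitInterval)) (a : Fin n → Fin 2) {t : Fin n} (ht : m ≤ (t : ℕ)) :
    exploitRecord b hm z a (t - m) =
      (b.advice (firstContexts hm z) (z t).1, a t, 1 - ((z t).2 (a t) : ℝ)) := by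
  have e : m + (t - m : ℕ) = t := by omega
  have h : m + (t - m : ℕ) < n := by rw [e]; exact t.isLt
  have e' : (⟨m + (t - m : ℕ), h⟩ : Fin n) = t := Fin.ext e
  rw [exploitRecord, dif_pos h, e']

theorem advice_nonneg (b : RepresentativeRule F m) (x : Fin m → X) (y : X) (j : ℕ) (i : Fin 2) :
    0 ≤ b.advice x y j i := by
  unfold RepresentativeRule.advice
  split_ifs <;> norm_num

theorem exploitRecord_nonneg (b : RepresentativeRule F m) (hm : m ≤ n)
    (z : Fin n → X × (Fin 2 → unitInterval)) (a : Fin n → Fin 2) (s j : ℕ) (i : Fin 2) :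
    0 ≤ (exploitRecord b hm z a s).1 j i := by
  unfold exploitRecord
  split_ifs with h
  · exact advice_nonneg b _ _ j i
  · dsimp only
    split_ifs <;> norm_num

theorem exploitRecord_sum (b : RepresentativeRule F m) (hm : m ≤ n)
    (z : Fin n → X × (Fin 2 → unitInterval)) (a : Fin n → Fin 2) (s j : ℕ) :
    ∑ i, (exploitRecord b hm z a s).1 j i = 1 := by
  unfold exploitRecord
  split_ifs with h <;> simp [RepresentativeRule.advice]

theorem exploitRecord_gain_mem (b : RepresentativeRule F m) (hm : m ≤ n)
    (z : Fin n → X × (Fin 2 → unitInterval)) (a : Fin n → Fin 2) (s : ℕ) :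
    (exploitRecord b hm z a s).2.2 ∈ Set.Icc (0 : ℝ) 1 := by
  unfold exploitRecord
  split_ifs with h
  · have h1 := ((z ⟨m + s, h⟩).2 (a ⟨m + s, h⟩)).2
    exact ⟨by linarith [h1.2], by linarith [h1.1]⟩
  · simp

theorem ve_prob_history (hF : F.Nonempty) (b : RepresentativeRule F m) (δ : ℝ) (hm : m ≤ n)
    (z : Fin n → X × (Fin 2 → unitInterval)) (a : Fin n → Fin 2) {t : Fin n} (ht : m ≤ (t : ℕ))
    (i : Fin 2) :
    (ve hF b n δ).prob t (history z a t) (z t).1 i =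
      exp4pArmProb (b.size (firstContexts hm z)) 2 (n - m)
        (exp4pScore (b.size (firstContexts hm z)) 2 (n - m) (δ / 3) (t - m)
          fun s => exploitRecord b hm z a s)
        (exploitRecord b hm z a (t - m)).1 i := by
  rw [exploitRecord_sub b hm z a ht]
  change veProb b n δ t (history z a t) (z t).1 i = _
  unfold veProb
  rw [dif_pos ht]
  have hrec : (fun s : Fin (t - m : ℕ) => exploitRecord b hm z a s) = fun s : Fin (t - m : ℕ) =>
      (b.advice (firstContexts hm z) (z ⟨m + s, by omega⟩).1, a ⟨m + s, by omega⟩,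
        1 - ((z ⟨m + s, by omega⟩).2 (a ⟨m + s, by omega⟩) : ℝ)) := by
    funext s
    rw [exploitRecord, dif_pos]
  rw [hrec]
  rfl

theorem exp4pScore_eq_sum (N K T : ℕ) (δ : ℝ) (r : ℕ → (ℕ → Fin K → ℝ) × Fin K × ℝ) (t j : ℕ) :
    exp4pScore N K T δ t (fun s => r s) j = ∑ s ∈ Finset.range t, ∑ i, (r s).1 j i *
      (((if (r s).2.1 = i then (r s).2.2 else 0) + exp4pBias N K T δ) /
        exp4pArmProb N K T (exp4pScore N K T δ s fun s => r s) (r s).1 i) := by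
  induction t with
  | zero => rfl
  | succ t ih =>
    rw [Finset.sum_range_succ, ← ih]
    rfl

/-- The estimated gain of the `j`-th policy, in terms of the arms VE plays. -/
theorem exp4pScore_exploitRecord (hF : F.Nonempty) (b : RepresentativeRule F m) (δ : ℝ)
    (hm : m ≤ n) (z : Fin n → X × (Fin 2 → unitInterval)) (a : Fin n → Fin 2) (j : ℕ) :
    exp4pScore (b.size (firstContexts hm z)) 2 (n - m) (δ / 3) (n - m)
        (fun s => exploitRecord b hm z a s) j =
      ∑ t ∈ roundsFrom m n,
        ((if a t = b.policy (firstContexts hm z) j (z t).1 then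
            1 - ((z t).2 (b.policy (firstContexts hm z) j (z t).1) : ℝ) else 0) +
          exp4pBias (b.size (firstContexts hm z)) 2 (n - m) (δ / 3)) /
        (ve hF b n δ).prob t (history z a t) (z t).1
          (b.policy (firstContexts hm z) j (z t).1) := by
  rw [exp4pScore_eq_sum, sum_range_sub_eq_sum_roundsFrom]
  refine Finset.sum_congr rfl fun t ht => ?_
  have ht' := mem_roundsFrom.1 ht
  simp only [ve_prob_history hF b δ hm z a ht']
  rw [exploitRecord_sub b hm z a ht']
  simp only [RepresentativeRule.advice]
  simp only [ite_mul, one_mul, zero_mul, Finset.sum_ite_eq, Finset.mem_univ, if_true]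
  congr 2
  split_ifs with h
  · rw [h]
  · rfl

/-- The high-probability regret bound of Exp4.P against a single expert, conditionally on the data
and in the non-trivial regime of small exploration rate and bias. -/
theorem ve_exploit_of_minProb (hF : F.Nonempty) (b : RepresentativeRule F m) {δ : ℝ} (hδ : 0 < δ)
    (hm : m < n) (z : Fin n → X × (Fin 2 → unitInterval))
    {N : ℕ} (hN : b.size (firstContexts hm.le z) = N) (hN2 : 2 ≤ N)
    {p β : ℝ} (hp : exp4pMinProb N 2 (n - m) = p)
    (hβ : exp4pBias N 2 (n - m) (δ / 3) = β) (hp0 : 0 < p) (hp1 : 2 * p ≤ 1 / 2) (hβ0 : 0 < β)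
    (hβ1 : β ≤ 1) {j : ℕ} (hj : j < N) :
    ((ve hF b n δ).playKernel n z).real {a | ¬ ∑ t ∈ roundsFrom m n, ((z t).2 (a t) : ℝ) ≤
      ∑ t ∈ roundsFrom m n, ((z t).2 (b.policy (firstContexts hm.le z) j (z t).1) : ℝ) +
        (2 * Real.log N / p + 12 * ((n - m) * p) + 8 * ((n - m) * β) +
          2 * Real.log (6 / δ) + Real.log (N / (δ / 3)) / β)} ≤ δ / 3 := by
  set π := ve hF b n δ with hπ
  set c : Fin n → Fin 2 := fun t => b.policy (firstContexts hm.le z) j (z t).1 with hc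
  set y : Fin n → ℝ := fun t => 1 - ((z t).2 (c t) : ℝ) with hy
  have hy01 : ∀ t, 0 ≤ y t ∧ y t ≤ 1 := fun t => by
    have h := ((z t).2 (c t)).2
    exact ⟨by linarith [h.2], by linarith [h.1]⟩
  have hP : ∀ (t : Fin n) (a : Fin n → Fin 2), m ≤ (t : ℕ) → ∀ i,
      p ≤ π.prob t (history z a t) (z t).1 i := fun t a ht i => by
    rw [hπ, ve_prob_history hF b δ hm.le z a ht, ← hp, hN]
    exact exp4pArmProb_ge_minProb _ (fun j i => exploitRecord_nonneg b hm.le z a _ j i) i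
  set ψ : (t : Fin n) → (Fin t → X × Fin 2 × unitInterval) → Fin 2 → ℝ := fun t h i =>
    if m ≤ (t : ℕ) then β * (y t - ((if i = c t then y t else 0) + β) / π.prob t h (z t).1 (c t))
    else 0 with hψdef
  set χ : (t : Fin n) → (Fin t → X × Fin 2 × unitInterval) → Fin 2 → ℝ := fun t h i =>
    if m ≤ (t : ℕ) then p / π.prob t h (z t).1 i - 2 * ((2 : ℕ) * p) else 0 with hχdef
  have hψ : ∀ (t : Fin n) (a : Fin n → Fin 2), ∑ i, π.prob t (history z a t) (z t).1 i *
      Real.exp (ψ t (history z a t) i) ≤ 1 := by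
    intro t a
    by_cases ht : m ≤ (t : ℕ)
    · simp only [hψdef, if_pos ht]
      exact sum_mul_exp_estimate_le_one (fun i => hp0.trans_le (hP t a ht i)) (π.sum_prob _ _ _)
        hβ0.le hβ1 (hy01 t).1 (hy01 t).2 (c t)
    · simp only [hψdef, if_neg ht, Real.exp_zero, mul_one]
      exact (π.sum_prob _ _ _).le
  have hχ : ∀ (t : Fin n) (a : Fin n → Fin 2), ∑ i, π.prob t (history z a t) (z t).1 i *
      Real.exp (χ t (history z a t) i) ≤ 1 := by
    intro t a
    by_cases ht : m ≤ (t : ℕ)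
    · simp only [hχdef, if_pos ht]
      exact sum_mul_exp_inv_le_one hp0 (hP t a ht) (π.sum_prob _ _ _)
    · simp only [hχdef, if_neg ht, Real.exp_zero, mul_one]
      exact (π.sum_prob _ _ _).le
  have hN0 : (0 : ℝ) < N := by exact_mod_cast (by omega : 0 < N)
  have h1 := π.playKernel_real_sum_ge_le z ψ hψ (Real.log (N / (δ / 3)))
  have h2 := π.playKernel_real_sum_ge_le z χ hχ (Real.log (6 / δ))
  rw [← Real.log_inv, Real.exp_log (by positivity)] at h1 h2
  -- The threshold `log (N / (δ / 3)) / β` gives probability `δ / (3 N)`, at most half of `δ / 3`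
  -- because `N ≥ 2`; the other half is for the event on the inverse probabilities.
  have h1' : (N / (δ / 3))⁻¹ ≤ δ / 6 := by
    have : (2 : ℝ) ≤ N := by exact_mod_cast hN2
    rw [inv_div, div_le_iff₀ hN0]
    nlinarith
  have h2' : (6 / δ)⁻¹ = δ / 6 := inv_div _ _
  refine (measureReal_mono
    (s₂ := {a | Real.log (N / (δ / 3)) ≤ ∑ t, ψ t (history z a t) (a t)} ∪
      {a | Real.log (6 / δ) ≤ ∑ t, χ t (history z a t) (a t)}) ?_).trans
    ((measureReal_union_le _ _).trans ((add_le_add (h1.trans h1') (h2.trans h2'.le)).trans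
      (by linarith)))
  intro a ha
  by_contra hcon
  rw [Set.mem_union, not_or] at hcon
  obtain ⟨hc1, hc2⟩ := hcon
  simp only [Set.mem_ofPred_eq, not_le] at hc1 hc2
  apply ha
  have hnm : ((roundsFrom m n).card : ℝ) = n - m := card_roundsFrom hm.le
  simp only [hψdef, hχdef, ← Finset.sum_filter] at hc1 hc2
  change ∑ t ∈ roundsFrom m n, _ < _ at hc1
  change ∑ t ∈ roundsFrom m n, _ < _ at hc2
  have hscore := exp4pScore_exploitRecord hF b δ hm.le z a j
  have hle := exp4pScore_le (K := 2) (T := n - m) (δ := δ / 3) (exploitRecord b hm.le z a)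
    (exploitRecord_nonneg b hm.le z a) (exploitRecord_sum b hm.le z a)
    (exploitRecord_gain_mem b hm.le z a) (N := N) (hp.symm ▸ hp0)
    (by rw [hp]; exact_mod_cast hp1) (hβ.symm ▸ hβ1) hj
  rw [sum_range_sub_eq_sum_roundsFrom, hp, hβ] at hle
  rw [hN, hβ] at hscore
  rw [hscore] at hle
  have hsum : ∑ t ∈ roundsFrom m n,
      ((exploitRecord b hm.le z a (t - m)).2.2 + 2 * ((2 : ℕ) * p) + 4 * ((2 : ℕ) * β) +
        2 * (p / exp4pArmProb N 2 (n - m) (exp4pScore N 2 (n - m) (δ / 3) (t - m)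
          fun s => exploitRecord b hm.le z a s) (exploitRecord b hm.le z a (t - m)).1
            (exploitRecord b hm.le z a (t - m)).2.1)) =
      ∑ t ∈ roundsFrom m n, ((1 - ((z t).2 (a t) : ℝ)) + 4 * p + 8 * β +
        2 * (p / π.prob t (history z a t) (z t).1 (a t))) := by
    refine Finset.sum_congr rfl fun t ht => ?_
    have ht' := mem_roundsFrom.1 ht
    rw [hπ, ve_prob_history hF b δ hm.le z a ht', hN, exploitRecord_sub b hm.le z a ht']
    push_cast
    ring
  rw [hsum] at hle
  set Q := ∑ t ∈ roundsFrom m n, p / π.prob t (history z a t) (z t).1 (a t) with hQ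
  set Sc := ∑ t ∈ roundsFrom m n, ((if a t = c t then y t else 0) + β) /
    π.prob t (history z a t) (z t).1 (c t) with hSc
  set LA := ∑ t ∈ roundsFrom m n, ((z t).2 (a t) : ℝ) with hLA
  set LC := ∑ t ∈ roundsFrom m n, ((z t).2 (c t) : ℝ) with hLC
  have e1 : ∑ t ∈ roundsFrom m n, y t = (n - m) - LC := by
    simp only [hy, Finset.sum_sub_distrib, Finset.sum_const, nsmul_eq_mul, mul_one, hnm, hLC]
  rw [← Finset.mul_sum, Finset.sum_sub_distrib, e1] at hc1
  rw [Finset.sum_sub_distrib, Finset.sum_const, nsmul_eq_mul, hnm] at hc2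
  simp only [Finset.sum_add_distrib, Finset.sum_sub_distrib, Finset.sum_const, nsmul_eq_mul,
    mul_one, hnm, ← Finset.mul_sum] at hle
  rw [mul_comm, ← lt_div_iff₀ hβ0] at hc1
  change Sc ≤ _ at hle
  change (n - m : ℝ) - LC - Sc < _ at hc1
  change Q - _ < _ at hc2
  push_cast at hc2
  change LA ≤ LC + _
  linarith

/-- With a single expert, VE follows it in the exploitation rounds. -/
theorem ve_prob_of_size_eq_one (hF : F.Nonempty) (b : RepresentativeRule F m) (δ : ℝ)
    (hm : m ≤ n) (z : Fin n → X × (Fin 2 → unitInterval))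
    (hN : b.size (firstContexts hm z) = 1) (a : Fin n → Fin 2) {t : Fin n} (ht : m ≤ (t : ℕ))
    (i : Fin 2) :
    (ve hF b n δ).prob t (history z a t) (z t).1 i =
      if b.policy (firstContexts hm z) 0 (z t).1 = i then 1 else 0 := by
  rw [ve_prob_history hF b δ hm z a ht, exploitRecord_sub b hm z a ht, hN]
  have hp : exp4pMinProb 1 2 (n - m) = 0 := by simp [exp4pMinProb]
  simp only [exp4pArmProb, exp4pExpertProb, hp, RepresentativeRule.advice, Finset.sum_range_one]
  simp

/-- The high-probability regret bound of Exp4.P against a single expert, conditionally on the data.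
The common bound `ρ` for the exploration rate and the bias may be taken to be
`√(log (3 N / δ) / (2 (n - m)))`. -/
theorem ve_exploit (hF : F.Nonempty) (b : RepresentativeRule F m) {δ : ℝ} (hδ : 0 < δ)
    (hδ1 : δ < 1) (hm : m < n) (z : Fin n → X × (Fin 2 → unitInterval)) {ρ : ℝ}
    (hρ1 : ρ ≤ 1 / 4)
    (hρ : Real.log (b.size (firstContexts hm.le z) / (δ / 3)) ≤ 2 * (n - m) * ρ ^ 2) (hρ0 : 0 ≤ ρ)
    {j : ℕ} (hj : j < b.size (firstContexts hm.le z)) :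
    ((ve hF b n δ).playKernel n z).real {a | ¬ ∑ t ∈ roundsFrom m n, ((z t).2 (a t) : ℝ) ≤
      ∑ t ∈ roundsFrom m n, ((z t).2 (b.policy (firstContexts hm.le z) j (z t).1) : ℝ) +
        (26 * ((n - m) * ρ) + 2 * Real.log (6 / δ))} ≤ δ / 3 := by
  generalize hN : b.size (firstContexts hm.le z) = N at *
  have hT : (0 : ℝ) < n - m := by
    have : (m : ℝ) < n := by exact_mod_cast hm
    linarith
  have hlog6 : 0 ≤ Real.log (6 / δ) := Real.log_nonneg (by rw [le_div_iff₀ hδ]; linarith)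
  rcases Nat.lt_or_ge N 2 with hN1 | hN2
  · obtain rfl : N = 1 := by omega
    obtain rfl : j = 0 := by omega
    refine (measureReal_mono ?_).trans
      (((ve hF b n δ).playKernel_real_exists_prob_eq_zero z).le.trans (by positivity))
    intro a ha
    by_contra hcon
    simp only [Set.mem_ofPred_eq, not_exists] at hcon
    apply ha
    have : ∀ t ∈ roundsFrom m n, ((z t).2 (a t) : ℝ) =
        ((z t).2 (b.policy (firstContexts hm.le z) 0 (z t).1) : ℝ) := by
      intro t ht
      have h := hcon t
      rw [ve_prob_of_size_eq_one hF b δ hm.le z hN a (mem_roundsFrom.1 ht)] at h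
      rw [← not_not.1 fun hne => h (if_neg hne)]
    rw [Finset.sum_congr rfl this]
    have : 0 ≤ 26 * ((n - m : ℝ) * ρ) := by positivity
    linarith
  · have hN2' : (2 : ℝ) ≤ N := by exact_mod_cast hN2
    have hN0 : (0 : ℝ) < N := by linarith
    have hcast : ((n - m : ℕ) : ℝ) = n - m := Nat.cast_sub hm.le
    have hlogN : 0 < Real.log N := Real.log_pos (by linarith)
    have hlogle : Real.log N ≤ Real.log (N / (δ / 3)) :=
      Real.log_le_log hN0 (by rw [le_div_iff₀ (by positivity)]; nlinarith)
    have hsq : ∀ u : ℝ, u ≤ Real.log (N / (δ / 3)) → √(u / (2 * (n - m))) ≤ ρ := fun u hu => by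
      rw [Real.sqrt_le_left hρ0, div_le_iff₀ (by positivity)]
      linarith
    have hp : exp4pMinProb N 2 (n - m) = √(Real.log N / (2 * (n - m))) := by
      rw [exp4pMinProb, hcast]
      push_cast
      exact min_eq_right ((hsq _ hlogle).trans (by linarith))
    have hβ : exp4pBias N 2 (n - m) (δ / 3) = √(Real.log (N / (δ / 3)) / (2 * (n - m))) := by
      rw [exp4pBias, hcast]
      push_cast
      rfl
    have hself : ∀ u : ℝ, 0 < u → u / √(u / (2 * (n - m))) =
        2 * ((n - m) * √(u / (2 * (n - m)))) := fun u hu => by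
      have h0 : 0 < √(u / (2 * (n - m))) := Real.sqrt_pos.2 (by positivity)
      rw [div_eq_iff h0.ne']
      have h2 := Real.sq_sqrt (by positivity : 0 ≤ u / (2 * (n - m : ℝ)))
      rw [eq_div_iff (by positivity)] at h2
      linarith
    have hp0 : 0 < √(Real.log N / (2 * (n - m) : ℝ)) := Real.sqrt_pos.2 (by positivity)
    have hβ0 : 0 < √(Real.log (N / (δ / 3)) / (2 * (n - m) : ℝ)) :=
      Real.sqrt_pos.2 (div_pos (hlogN.trans_le hlogle) (by positivity))
    have hpρ := hsq _ hlogle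
    have hβρ := hsq _ le_rfl
    have h := ve_exploit_of_minProb hF b hδ hm z hN hN2 hp hβ hp0 (by linarith) hβ0
      (by linarith) hj
    refine (measureReal_mono ?_).trans h
    intro a ha hcon
    apply ha
    refine hcon.trans ?_
    rw [mul_div_assoc, hself _ hlogN, hself _ (hlogN.trans_le hlogle)]
    have h1 := mul_le_mul_of_nonneg_left hpρ hT.le
    have h2 := mul_le_mul_of_nonneg_left hβρ hT.le
    linarith

end Exploitation

/-! ### The representatives generalize -/

section Disagreement

variable {X : Type*} {F : Set (X → Fin 2)} {m n : ℕ}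

/-- The rounds in which the policies `f` and `g` play different arms. -/
def disagreement (f g : X → Fin 2) (x : Fin n → X) : Finset (Fin n) :=
  Finset.univ.filter fun t => f (x t) ≠ g (x t)

variable [MeasurableSpace X]

theorem RepresentativeRule.size_le_card_traces (b : RepresentativeRule F m) (x : Fin m → X) :
    b.size x ≤ (traces F x).card := by
  classical
  set A : ℕ → Finset (Fin m) := fun j => Finset.univ.filter fun t => b.policy x j (x t) = 1 with hA
  have hmem : ∀ j < b.size x, A j ∈ traces F x := fun j hj =>
    mem_traces.2 ⟨_, b.policy_mem x j hj, by simp [hA]⟩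
  have hinj : Set.InjOn A (Finset.range (b.size x)) := by
    intro j hj k hk hjk
    simp only [Finset.coe_range, Set.mem_Iio] at hj hk
    have h := (b.existsUnique x _ (b.policy_mem x j hj)).unique ⟨hj, fun _ => rfl⟩ (y₂ := k)
    refine h ⟨hk, fun t => fin_two_eq_of_iff ?_⟩
    have : t ∈ A j ↔ t ∈ A k := by rw [hjk]
    simpa [hA] using this
  simpa using Finset.card_le_card_of_injOn A (fun j hj => hmem j (by simpa using hj)) hinj

/-- The event that some policy listed by `b` agrees with `f` on the first `m` contexts, but not on
more than `k` of all contexts. -/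
def misrepresented (b : RepresentativeRule F m) (hm : m ≤ n) (f : X → Fin 2) (k : ℝ) :
    Set (Fin n → X × (Fin 2 → unitInterval)) :=
  {z | ∃ j < b.size (firstContexts hm z),
    (∀ s, f (firstContexts hm z s) =
      b.policy (firstContexts hm z) j (firstContexts hm z s)) ∧
    k < (disagreement f (b.policy (firstContexts hm z) j) fun t => (z t).1).card}

theorem measurable_firstContexts (hm : m ≤ n) :
    Measurable fun z : Fin n → X × (Fin 2 → unitInterval) => firstContexts hm z := by
  unfold firstContexts
  fun_prop

theorem measurableSet_misrepresented (b : RepresentativeRule F m) (hm : m ≤ n) {f : X → Fin 2}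
    (hf : Measurable f) (k : ℝ) : MeasurableSet (misrepresented b hm f k) := by
  classical
  have hx := measurable_firstContexts (X := X) hm
  have hpol : ∀ (j : ℕ) (t : Fin n), Measurable fun z : Fin n → X × (Fin 2 → unitInterval) =>
      b.policy (firstContexts hm z) j (z t).1 := fun j t =>
    (b.measurable_policy j).comp (hx.prodMk (by fun_prop))
  have hfm : ∀ t : Fin n, Measurable fun z : Fin n → X × (Fin 2 → unitInterval) => f (z t).1 :=
    fun t => hf.comp (by fun_prop)
  have heq : misrepresented b hm f k = ⋃ j : ℕ,
      ({z | j < b.size (firstContexts hm z)} ∩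
      ((⋂ s : Fin m, {z | f (z (Fin.castLE hm s)).1 =
        b.policy (firstContexts hm z) j (z (Fin.castLE hm s)).1}) ∩
      {z | k < ∑ t : Fin n,
        if f (z t).1 ≠ b.policy (firstContexts hm z) j (z t).1 then (1 : ℝ) else 0})) := by
    ext z
    simp only [misrepresented, disagreement, Set.mem_ofPred_eq, Set.mem_iUnion, Set.mem_inter_iff,
      Set.mem_iInter, Finset.sum_boole]
    rfl
  rw [heq]
  refine MeasurableSet.iUnion fun j => MeasurableSet.inter ?_ (MeasurableSet.inter ?_ ?_)
  · exact measurableSet_lt measurable_const (b.measurable_size.comp hx)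
  · exact MeasurableSet.iInter fun s => measurableSet_eq_fun (hfm _) (hpol j _)
  · refine measurableSet_lt measurable_const (Finset.measurable_fun_sum _ fun t _ => ?_)
    exact Measurable.ite (measurableSet_eq_fun (hfm t) (hpol j t)).compl measurable_const
      measurable_const

/-- Given the unordered sample, the policies of `F` have only finitely many traces, and a trace
that differs from that of `f` in more than `k` places rarely agrees with it on `m` random places. -/
theorem measure_misrepresented_le (b : RepresentativeRule F m) (hm : m ≤ n) {f : X → Fin 2}
    (hf : Measurable f) (k : ℝ) (D : Measure (X × (Fin 2 → unitInterval)))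
    [IsProbabilityMeasure D] {M : ℝ} (hM : ∀ x : Fin n → X, ((traces F x).card : ℝ) ≤ M) :
    (Measure.pi fun _ : Fin n => D) (misrepresented b hm f k) ≤
      ENNReal.ofReal (M * Real.exp (-(k * m / n))) := by
  classical
  refine pi_measure_le_of_card_perm_le D (measurableSet_misrepresented b hm hf k) fun z P hP => ?_
  set x : Fin n → X := fun t => (z t).1 with hx
  set S : Finset (Fin n) → Finset (Fin n) := fun A =>
    Finset.univ.filter fun t => ¬ (t ∈ A ↔ f (x t) = 1) with hS
  have hsub : P ⊆ ((traces F x).filter fun A => k < (S A).card).biUnion fun A =>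
      Finset.univ.filter fun σ : Equiv.Perm (Fin n) => ∀ s : Fin n, (s : ℕ) < m → σ s ∉ S A := by
    intro σ hσ
    obtain ⟨j, hj, hagree, hk⟩ := hP σ hσ
    set g := b.policy (firstContexts hm fun t => z (σ t)) j with hg
    set A : Finset (Fin n) := Finset.univ.filter fun t => g (x t) = 1 with hA
    have hSA : ∀ t, t ∈ S A ↔ f (x t) ≠ g (x t) := fun t => by
      simp only [hS, hA, Finset.mem_filter, Finset.mem_univ, true_and]
      refine not_congr ⟨fun h => (fin_two_eq_of_iff h).symm, fun h => by rw [h]⟩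
    refine Finset.mem_biUnion.2 ⟨A, Finset.mem_filter.2
      ⟨mem_traces.2 ⟨g, b.policy_mem _ j hj, by simp [hA]⟩, ?_⟩, ?_⟩
    · refine hk.trans_le ?_
      have : (disagreement f g fun t => (z (σ t)).1).card ≤ (S A).card := by
        refine Finset.card_le_card_of_injOn σ (fun t ht => ?_) σ.injective.injOn
        have ht' : f (z (σ t)).1 ≠ g (z (σ t)).1 := by simpa [disagreement] using ht
        exact (hSA (σ t)).2 ht'
      exact_mod_cast this
    · refine Finset.mem_filter.2 ⟨Finset.mem_univ _, fun s hs hmem => ?_⟩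
      exact (hSA _).1 hmem (hagree ⟨s, hs⟩)
  have hM0 : 0 ≤ Real.exp (-(k * m / n)) * (n.factorial : ℝ) := by positivity
  calc (P.card : ℝ) ≤ ∑ A ∈ (traces F x).filter fun A => k < (S A).card,
        ((Finset.univ.filter fun σ : Equiv.Perm (Fin n) =>
          ∀ s : Fin n, (s : ℕ) < m → σ s ∉ S A).card : ℝ) := by
        exact_mod_cast (Finset.card_le_card hsub).trans Finset.card_biUnion_le
    _ ≤ ∑ A ∈ (traces F x).filter fun A => k < (S A).card,
        Real.exp (-(k * m / n)) * n.factorial := by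
        refine Finset.sum_le_sum fun A hA => (card_perm_forall_lt_notMem_le (S A) hm).trans ?_
        have hkA := (Finset.mem_filter.1 hA).2
        gcongr
    _ ≤ M * (Real.exp (-(k * m / n)) * n.factorial) := by
        rw [Finset.sum_const, nsmul_eq_mul]
        refine mul_le_mul_of_nonneg_right (le_trans ?_ (hM x)) hM0
        exact_mod_cast Finset.card_filter_le _ _
    _ = M * Real.exp (-(k * m / n)) * n.factorial := by ring

end Disagreement

/-! ### The regret of VE -/

section Regret

variable {X : Type*} [MeasurableSpace X]

theorem measurable_policyLoss {f : X → Fin 2} (hf : Measurable f) :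
    Measurable fun z : X × (Fin 2 → unitInterval) => (z.2 (f z.1) : ℝ) := by
  have h : (fun z : X × (Fin 2 → unitInterval) => (z.2 (f z.1) : ℝ)) =
      fun z => if f z.1 = 0 then (z.2 0 : ℝ) else (z.2 1 : ℝ) := by
    funext z
    split_ifs with h
    · rw [h]
    · rw [Fin.eq_one_of_ne_zero _ h]
  rw [h]
  exact Measurable.ite ((measurableSet_singleton 0).preimage (hf.comp measurable_fst))
    (by fun_prop) (by fun_prop)

theorem measurable_regret (D : Measure (X × (Fin 2 → unitInterval))) (F : Set (X → Fin 2))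
    (n : ℕ) : Measurable
      fun w : (Fin n → X × (Fin 2 → unitInterval)) × (Fin n → Fin 2) => regret D F w.1 w.2 := by
  unfold regret
  refine Measurable.sub_const (Finset.measurable_fun_sum _ fun t _ => ?_) _
  exact (measurable_policyLoss (X := (Fin n → X × (Fin 2 → unitInterval)) × (Fin n → Fin 2))
    (f := fun w => w.2 t) (by fun_prop)).comp
      (g := fun z : ((Fin n → X × (Fin 2 → unitInterval)) × (Fin n → Fin 2)) ×
        (Fin 2 → unitInterval) => (z.2 (z.1.2 t) : ℝ))
      (f := fun w => (w, (w.1 t).2)) (by fun_prop)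

theorem risk_nonneg (D : Measure (X × (Fin 2 → unitInterval))) (f : X → Fin 2) : 0 ≤ risk D f :=
  integral_nonneg fun z => (z.2 (f z.1)).2.1

/-- The regret never exceeds the number of rounds. -/
theorem regret_le (D : Measure (X × (Fin 2 → unitInterval))) (F : Set (X → Fin 2)) {n : ℕ}
    (z : Fin n → X × (Fin 2 → unitInterval)) (a : Fin n → Fin 2) : regret D F z a ≤ n := by
  have h1 : ∑ t, ((z t).2 (a t) : ℝ) ≤ ∑ _t : Fin n, (1 : ℝ) :=
    Finset.sum_le_sum fun t _ => ((z t).2 (a t)).2.2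
  have h2 : 0 ≤ (n : ℝ) * ⨅ f : F, risk D f :=
    mul_nonneg (Nat.cast_nonneg _) (Real.iInf_nonneg fun f => risk_nonneg D f)
  simp only [Finset.sum_const, Finset.card_univ, Fintype.card_fin, nsmul_eq_mul, mul_one] at h1
  unfold regret
  linarith

/-- An event fails with probability at most the sum of the probability that the data lie in `A` and
of the largest conditional probability of its failure on data outside `A`. -/
theorem Forecaster.le_law_real (π : Forecaster X 2) (D : Measure (X × (Fin 2 → unitInterval)))
    [IsProbabilityMeasure D] {n : ℕ}
    {G : Set ((Fin n → X × (Fin 2 → unitInterval)) × (Fin n → Fin 2))} (hG : MeasurableSet G)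
    (A : Set (Fin n → X × (Fin 2 → unitInterval))) {ε ε' : ℝ} (hε : 0 ≤ ε) (hε' : 0 ≤ ε')
    (hA : (Measure.pi fun _ : Fin n => D) A ≤ ENNReal.ofReal ε)
    (h : ∀ z ∉ A, (π.playKernel n z).real {a | (z, a) ∉ G} ≤ ε') :
    1 - (ε + ε') ≤ (π.law D n).real G := by
  have : IsProbabilityMeasure (π.law D n) := by unfold Forecaster.law; infer_instance
  have hc : (π.law D n) Gᶜ ≤ ENNReal.ofReal (ε + ε') := by
    unfold Forecaster.law
    rw [Measure.compProd_apply hG.compl]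
    calc ∫⁻ z, π.playKernel n z (Prod.mk z ⁻¹' Gᶜ) ∂(Measure.pi fun _ : Fin n => D)
        ≤ ∫⁻ z, (A.indicator 1 z + ENNReal.ofReal ε') ∂(Measure.pi fun _ : Fin n => D) := by
          refine lintegral_mono fun z => ?_
          by_cases hz : z ∈ A
          · simp only [Set.indicator_of_mem hz, Pi.one_apply]
            exact prob_le_one.trans le_self_add
          · simp only [Set.indicator_of_notMem hz, zero_add]
            have := h z hz
            rw [measureReal_def] at this
            exact (ENNReal.le_ofReal_iff_toReal_le (measure_ne_top _ _) hε').2 this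
      _ ≤ (Measure.pi fun _ : Fin n => D) A + ENNReal.ofReal ε' := by
          rw [lintegral_add_right _ measurable_const]
          refine add_le_add (lintegral_indicator_one_le _) (le_of_eq (by simp))
      _ ≤ ENNReal.ofReal (ε + ε') := by
          rw [ENNReal.ofReal_add hε hε']
          exact add_le_add_left hA _
  have hc' : (π.law D n).real Gᶜ ≤ ε + ε' := ENNReal.toReal_le_of_le_ofReal (by positivity) hc
  have := probReal_compl_eq_one_sub (μ := π.law D n) hG
  linarith

theorem nat_mul_log_exp_mul_div_nonneg {n d : ℕ} (h : d < n) :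
    0 ≤ d * Real.log (Real.exp 1 * n / d) := by
  rcases Nat.eq_zero_or_pos d with rfl | hd
  · simp
  · have hd' : (0 : ℝ) < d := by exact_mod_cast hd
    refine mul_nonneg hd'.le (Real.log_nonneg ?_)
    rw [le_div_iff₀ hd', one_mul]
    have h1 : (d : ℝ) ≤ n := by exact_mod_cast h.le
    have h2 : (1 : ℝ) ≤ Real.exp 1 := Real.one_le_exp zero_le_one
    nlinarith

theorem one_le_log_three_div {δ : ℝ} (hδ : 0 < δ) (hδ1 : δ < 1) : 1 ≤ Real.log (3 / δ) := by
  rw [Real.le_log_iff_exp_le (by positivity), le_div_iff₀ hδ]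
  nlinarith [Real.exp_one_lt_d9, Real.exp_pos 1]

/-- Replacing a near-optimal policy `f` by the representative of its trace costs at most one per
disagreement. -/
theorem regret_le_of_events {F : Set (X → Fin 2)} {m n : ℕ} (hm : m ≤ n)
    (D : Measure (X × (Fin 2 → unitInterval))) {f g : X → Fin 2}
    {z : Fin n → X × (Fin 2 → unitInterval)} {a : Fin n → Fin 2} {S R : ℝ}
    (hf : n * risk D f ≤ n * (⨅ h : F, risk D h) + 1)
    (hdis : ((disagreement f g fun t => (z t).1).card : ℝ) ≤ S)
    (hdev : ∑ t, ((z t).2 (f (z t).1) : ℝ) ≤ n * risk D f + S)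
    (hplay : ∑ t ∈ roundsFrom m n, ((z t).2 (a t) : ℝ) ≤
      ∑ t ∈ roundsFrom m n, ((z t).2 (g (z t).1) : ℝ) + R) :
    regret D F z a ≤ m + 2 * S + R + 1 := by
  classical
  have hsplit : ∑ t, ((z t).2 (a t) : ℝ) ≤ m + ∑ t ∈ roundsFrom m n, ((z t).2 (a t) : ℝ) := by
    rw [← Finset.sum_add_sum_compl (roundsFrom m n), add_comm]
    gcongr
    calc ∑ t ∈ (roundsFrom m n)ᶜ, ((z t).2 (a t) : ℝ)
        ≤ ∑ t ∈ (roundsFrom m n)ᶜ, (1 : ℝ) := Finset.sum_le_sum fun t _ => ((z t).2 (a t)).2.2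
      _ = m := by
        rw [Finset.sum_const, nsmul_eq_mul, mul_one, Finset.card_compl, Fintype.card_fin,
          Nat.cast_sub (by simpa using (roundsFrom m n).card_le_univ), card_roundsFrom hm]
        ring
  have hswap : ∑ t ∈ roundsFrom m n, ((z t).2 (g (z t).1) : ℝ) ≤
      ∑ t, ((z t).2 (f (z t).1) : ℝ) + (disagreement f g fun t => (z t).1).card := by
    calc ∑ t ∈ roundsFrom m n, ((z t).2 (g (z t).1) : ℝ) ≤ ∑ t, ((z t).2 (g (z t).1) : ℝ) :=
          Finset.sum_le_sum_of_subset_of_nonneg (Finset.subset_univ _)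
            fun t _ _ => ((z t).2 _).2.1
      _ ≤ ∑ t, (((z t).2 (f (z t).1) : ℝ) + if f (z t).1 ≠ g (z t).1 then 1 else 0) := by
          refine Finset.sum_le_sum fun t _ => ?_
          have h1 := ((z t).2 (g (z t).1)).2.2
          have h2 := ((z t).2 (f (z t).1)).2.1
          split_ifs with h
          · linarith
          · rw [not_not.1 h, add_zero]
      _ = _ := by
          rw [Finset.sum_add_distrib, Finset.sum_boole]
          rfl
  unfold regret
  linarith

/-- The regret bound with `c = 36` in the non-trivial regime of few exploration rounds. -/
theorem ve_regret_of_large {F : Set (X → Fin 2)} (hF : F.Nonempty) {d n m : ℕ} {δ : ℝ}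
    (b : RepresentativeRule F m) (D : Measure (X × (Fin 2 → unitInterval)))
    [IsProbabilityMeasure D] (hFm : ∀ f ∈ F, Measurable f) (hd : HasVCDim F d) (hdn : d < n)
    (hδ : 0 < δ) (hδ1 : δ < 1) {L S : ℝ}
    (hL : L = d * Real.log (Real.exp 1 * n / d) + Real.log (3 / δ)) (hS : S = √(n * L))
    (hSm : S ≤ m) (hmS : m ≤ 3 * S) (hSn : 8 * S < n) :
    1 - δ ≤ ((ve hF b n δ).law D n).real {w | regret D F w.1 w.2 ≤ 36 * S} := by
  have hn : (0 : ℝ) < n := by exact_mod_cast (Nat.zero_le d).trans_lt hdn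
  have hn1 : (1 : ℝ) ≤ n := by exact_mod_cast (Nat.zero_le d).trans_lt hdn
  have hdL := nat_mul_log_exp_mul_div_nonneg hdn
  have hlog3 := one_le_log_three_div hδ hδ1
  have hL1 : 1 ≤ L := by linarith
  have hSsq : S ^ 2 = n * L := by rw [hS, Real.sq_sqrt (by positivity)]
  have hS1 : 1 ≤ S := by
    rw [hS]
    exact Real.one_le_sqrt.2 (one_le_mul_of_one_le_of_one_le hn1 hL1)
  have hmn' : (m : ℝ) < n := by linarith
  have hmn : m < n := by exact_mod_cast hmn'
  have hLS : L ≤ S / 8 := by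
    have : n * L ≤ n * (S / 8) := by rw [← hSsq]; nlinarith
    exact le_of_mul_le_mul_left this hn
  -- The infimum of the risk need not be attained.
  have hne : Nonempty F := hF.to_subtype
  obtain ⟨⟨f, hfF⟩, hf⟩ := exists_lt_of_ciInf_lt
    (show (⨅ f : F, risk D f) < (⨅ f : F, risk D f) + 1 / n by
      have := one_div_pos.2 hn
      linarith)
  have hf' : n * risk D f ≤ n * (⨅ h : F, risk D h) + 1 := by
    have := mul_le_mul_of_nonneg_left hf.le hn.le
    rw [mul_add, mul_one_div_cancel hn.ne'] at this
    exact this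
  have hfm := hFm f hfF
  set μ := Measure.pi fun _ : Fin n => D with hμ
  have hexpL : Real.exp (-L) = Real.exp (-(d * Real.log (Real.exp 1 * n / d))) * (δ / 3) := by
    rw [hL, neg_add, Real.exp_add, Real.exp_neg (Real.log _), Real.exp_log (by positivity), inv_div]
  have hB : μ (misrepresented b hmn.le f S) ≤ ENNReal.ofReal (δ / 3) := by
    refine (measure_misrepresented_le b hmn.le hfm S D
      (M := Real.exp (d * Real.log (Real.exp 1 * n / d))) fun x => ?_).trans
        (ENNReal.ofReal_le_ofReal ?_)
    · rcases Nat.eq_zero_or_pos (traces F x).card with h0 | h0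
      · rw [h0, Nat.cast_zero]
        exact (Real.exp_pos _).le
      · rw [← Real.log_le_iff_le_exp (by exact_mod_cast h0)]
        exact log_card_traces_le hF hd le_rfl hdn.le x
    · have hLm : L ≤ S * m / n := by
        rw [le_div_iff₀ hn]
        nlinarith
      calc _ ≤ Real.exp (d * Real.log (Real.exp 1 * n / d)) * Real.exp (-L) := by gcongr
        _ = δ / 3 := by
          rw [hexpL, ← mul_assoc, ← Real.exp_add, add_neg_cancel, Real.exp_zero, one_mul]
  have hC : μ {z | n * risk D f + S ≤ ∑ t, ((z t).2 (f (z t).1) : ℝ)} ≤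
      ENNReal.ofReal (δ / 3) := by
    have h := pi_measureReal_sum_ge_le D (measurable_policyLoss hfm)
      (fun z => (z.2 (f z.1)).2) (by omega : 0 < n) (by linarith : 0 ≤ S)
    refine (ENNReal.le_ofReal_iff_toReal_le (measure_ne_top _ _) (by positivity)).2 (h.trans ?_)
    calc Real.exp (-(2 * S ^ 2 / n)) ≤ Real.exp (-L) := by
          rw [Real.exp_le_exp, neg_le_neg_iff, hSsq, le_div_iff₀ hn]
          nlinarith
      _ ≤ δ / 3 := by
          rw [hexpL]
          exact mul_le_of_le_one_left (by positivity) (Real.exp_le_one_iff.2 (by linarith))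
  have hmeas : MeasurableSet {w : (Fin n → X × (Fin 2 → unitInterval)) × (Fin n → Fin 2) |
      regret D F w.1 w.2 ≤ 36 * S} := measurableSet_le (measurable_regret D F n) measurable_const
  have hunion : μ (misrepresented b hmn.le f S ∪
      {z | n * risk D f + S ≤ ∑ t, ((z t).2 (f (z t).1) : ℝ)}) ≤
        ENNReal.ofReal (δ / 3 + δ / 3) := by
    rw [ENNReal.ofReal_add (by positivity) (by positivity)]
    exact (measure_union_le _ _).trans (add_le_add hB hC)
  refine le_trans (by linarith) ((ve hF b n δ).le_law_real D hmeas _ (by positivity)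
    (by positivity : 0 ≤ δ / 3) hunion fun z hz => ?_)
  rw [Set.mem_union, not_or] at hz
  obtain ⟨hz1, hz2⟩ := hz
  simp only [Set.mem_ofPred_eq, not_le] at hz2
  obtain ⟨j, ⟨hj, hagree⟩, -⟩ := b.existsUnique (firstContexts hmn.le z) f hfF
  have hdis : ((disagreement f (b.policy (firstContexts hmn.le z) j)
      fun t => (z t).1).card : ℝ) ≤ S := by
    by_contra hcon
    exact hz1 ⟨j, hj, hagree, not_le.1 hcon⟩
  have hρ : Real.log (b.size (firstContexts hmn.le z) / (δ / 3)) ≤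
      2 * (n - m) * (S / n) ^ 2 := by
    have hpos : (0 : ℝ) < b.size (firstContexts hmn.le z) := by exact_mod_cast b.size_pos hF _
    have h1 : Real.log (b.size (firstContexts hmn.le z)) ≤
        d * Real.log (Real.exp 1 * n / d) := by
      refine le_trans (Real.log_le_log hpos ?_)
        (log_card_traces_le hF hd hmn.le hdn.le (firstContexts hmn.le z))
      exact_mod_cast b.size_le_card_traces _
    have h2 : Real.log (b.size (firstContexts hmn.le z) / (δ / 3)) ≤ L := by
      rw [← inv_div 3 δ, div_inv_eq_mul, Real.log_mul hpos.ne' (by positivity)]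
      linarith
    have h3 : 2 * (n - m) * (S / n) ^ 2 = L * (2 * (n - m) / n) := by
      rw [div_pow, hSsq]
      field_simp
    rw [h3]
    refine h2.trans (le_mul_of_one_le_right (by linarith) ?_)
    rw [one_le_div hn]
    linarith
  have hρ1 : S / n ≤ 1 / 4 := by
    rw [div_le_iff₀ hn]
    linarith
  refine (measureReal_mono ?_).trans (ve_exploit hF b hδ hδ1 hmn z hρ1 hρ (by positivity) hj)
  intro a ha hplay
  refine ha ((regret_le_of_events hmn.le D hf' hdis hz2.le hplay).trans ?_)
  have h6 : Real.log (6 / δ) ≤ 2 * L := by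
    have : Real.log (6 / δ) = Real.log 2 + Real.log (3 / δ) := by
      rw [← Real.log_mul two_ne_zero (by positivity)]
      congr 1
      ring
    have h2 : Real.log 2 ≤ 1 := (Real.log_two_lt_d9.le).trans (by norm_num)
    linarith
  have hTρ : (n - m) * (S / n) ≤ S := by
    rw [mul_div_assoc', div_le_iff₀ hn]
    nlinarith [Nat.cast_nonneg (α := ℝ) m]
  linarith

end Regret

end ContextualBandit

open ContextualBandit
theorem theorem4p6 :
    ∃ c : ℝ, 0 < c ∧
      ∀ (X : Type*) [MeasurableSpace X] (F : Set (X → Fin 2)) (hF : F.Nonempty) (d n : ℕ) (δ : ℝ)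
        (b : RepresentativeRule F (explorationRounds n d δ))
        (D : Measure (X × (Fin 2 → unitInterval))) [IsProbabilityMeasure D],
        (∀ f ∈ F, Measurable f) → HasVCDim F d → d < n → 0 < δ → δ < 1 →
          1 - δ ≤ ((ve hF b n δ).law D n).real
            {w | regret D F w.1 w.2 ≤
              c * √(n * (d * Real.log (Real.exp 1 * n / d) + Real.log (3 / δ)))} := by
  refine ⟨36, by norm_num, ?_⟩
  intro X _ F hF d n δ b D _ hFm hd hdn hδ hδ1
  set L := d * Real.log (Real.exp 1 * n / d) + Real.log (3 / δ) with hL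
  set S := √(n * L) with hS
  have hS0 : 0 ≤ S := Real.sqrt_nonneg _
  rcases le_or_gt (n : ℝ) (8 * S) with hsmall | hlarge
  · have : IsProbabilityMeasure ((ve hF b n δ).law D n) := by
      unfold Forecaster.law
      infer_instance
    have huniv : {w : (Fin n → X × (Fin 2 → unitInterval)) × (Fin n → Fin 2) |
        regret D F w.1 w.2 ≤ 36 * S} = Set.univ :=
      Set.eq_univ_of_forall fun w => (regret_le D F w.1 w.2).trans (by linarith)
    rw [huniv, probReal_univ]
    linarith
  · -- Up to rounding, `m` is the root `V` below, which exceeds `S` by a factor of at most `√2`.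
    have hn1 : (1 : ℝ) ≤ n := by exact_mod_cast (Nat.zero_le d).trans_lt hdn
    have hdL := nat_mul_log_exp_mul_div_nonneg hdn
    have hlog3 := one_le_log_three_div hδ hδ1
    have hS1 : 1 ≤ S := Real.one_le_sqrt.2 (one_le_mul_of_one_le_of_one_le hn1 (by linarith))
    set V := √(n * (2 * d * Real.log (Real.exp 1 * n / d) + Real.log (3 / δ))) with hV
    have hSV : S ≤ V := Real.sqrt_le_sqrt (mul_le_mul_of_nonneg_left (by linarith) (by linarith))
    have hVS : V ≤ 2 * S := by
      rw [hV, Real.sqrt_le_left (by linarith), mul_pow, hS, Real.sq_sqrt (by positivity)]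
      nlinarith
    refine ve_regret_of_large hF b D hFm hd hdn hδ hδ1 hL hS ?_ ?_ hlarge
    · unfold explorationRounds
      rw [Nat.cast_min]
      exact le_min (by linarith) (hSV.trans (Nat.le_ceil _))
    · unfold explorationRounds
      have h1 : ((min n ⌈V⌉₊ : ℕ) : ℝ) ≤ ⌈V⌉₊ := by exact_mod_cast min_le_right _ _
      have h2 := Nat.ceil_lt_add_one (hS0.trans hSV)
      linarith
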